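/- **Setting.** All toposes are Grothendieck toposes, and geometric morphisms (in particular points $\mathbf{Set}\to\mathcal E$) are taken up to isomorphism. Let $\mathcal U$ be the category of *toposes paired with points*: an object is a topos $\mathcal E$ together with a family $(p_x)_{x\in X}$ of points of $\mathcal E$ indexed by a set $X$; an arrow $(\mathcal E,(p_x)_{x\in X})\to(\mathcal F,(q_y)_{y\in Y})$ is a pair $(f,l)$ of a geometric morphism $f:\mathcal E\to\mathcal F$ and a function $l:X\to Y$ with $f\circ p_x\cong q_{l(x)}$ for all $x$. **The method.** Given functors $I:\mathcal H\to\mathcal U$ and $J:\mathcal K\to\mathcal U$, data for the method consist of relations $R,S\subseteq \mathrm{Ob}(\mathcal H)\times \mathrm{Ob}(\mathcal K)$, arrows $\xi_{(C,D)}:I(C)\to J(D)$ for $(C,D)\in R$ and $\chi_{(C,D)}:J(D)\to I(C)$ for $(C,D)\in S$, a function $Z:R\to S$ keeping second components, a function $W:S\to R$ keeping first components, isomorphisms $\epsilon_r:Z(r)_1\to r_1$ ($r\in R$) and arrows $\eta_s:s_2\to W(s)_2$ ($s\in S$), such that $\chi_{Z(r)}\circ\xi_r=I(\epsilon_r^{-1})$,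 $\xi_{W(s)}\circ\chi_s=J(\eta_s)$, and every $\xi_r$ and every $\eta_{Z(r)}$ is an isomorphism. Let $\tilde R$ be the category with objects the elements of $R$ and arrows $r\to r'$ the pairs $(u:r_1\to r'_1,\;v:r_2\to r'_2)$ with $\xi_{r'}\circ I(u)=J(v)\circ\xi_r$; let $\tilde S$ be the category with objects the elements of $S$ and arrows $s\to s'$ the triples $(z:s_1\to s'_1,\;v:s_2\to s'_2,\;w:W(s)_2\to W(s')_2)$ with $\chi_{s'}\circ J(v)=I(z)\circ\chi_s$ and $\xi_{W(s')}\circ I(z)=J(w)\circ\xi_{W(s)}$. There are functors $\tilde Z:\tilde R\to\tilde S$, equal to $Z$ on objects and with $\tilde Z(u,v)=(\epsilon_{r'}^{-1}u\,\epsilon_r,\;v,\;\eta_{Z(r')}v\,\eta_{Z(r)}^{-1})$, and $\tilde W:\tilde S\to\tilde R$, equal to $W$ on objects and with $\tilde W(z,v,w)=(z,w)$. The method *generates a reflection* when $\tilde W\dashv\tilde Z$ with unit $(\epsilon_{W(s)}^{-1},\eta_s,\eta_{Z(W(s))})$ and counit $(\epsilon_r,\eta_{Z(r)}^{-1})$,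 the counit being an isomorphism. In the functional case one is given $f:\mathrm{Ob}(\mathcal H)\to\mathrm{Ob}(\mathcal K)$ and $g:\mathrm{Ob}(\mathcal K)\to\mathrm{Ob}(\mathcal H)$, $R=\{(C,f(C))\}$, $S=\{(g(D),D)\}$, $Z(C,D)=(g(D),D)$, $W(C,D)=(C,f(C))$, and one writes $\xi_C,\chi_D$. The dual form (arrows $\alpha_C:J(f(C))\to I(C)$, $\beta_D:I(g(D))\to J(D)$) is the method applied to $(\mathcal H^{op},\mathcal K^{op},\mathcal U^{op},I^{op},J^{op})$. For a space $X$ let $J(X)$ be the topos $\mathrm{Sh}(X)$ paired with the points given by the elements of $X$; this is a functor $J:\mathbf{Top}\to\mathcal U$. **Statement.** (a) *Stone adjunction.* Let $I:\mathbf{BoolAlg}^{op}\to\mathcal U$ send a Boolean algebra $B$ to $\mathrm{Sh}(B,J_B)$ ($J_B$ the coherent, i.e. finite-cover, topology) paired with the set of all its points, and act on homomorphisms by the induced geometric morphisms. Let $f(B)=X_B$ be the Stone spectrum of $B$ and $g(X)=X_{cl}$ the Boolean algebra of clopen subsets of $X$. There are data for the method in the functional case consisting of isomorphisms $\xi_B:I(B)\to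 J(X_B)$, sending a point $p$ to the ultrafilter of those $b\in B$ whose associated subterminal object has nonempty inverse image under $p$, and arrows $\chi_X:J(X)\to I(X_{cl})$, sending $x\in X$ to the point corresponding in this way to $\{V\in X_{cl}: x\in V\}$. The method generates a reflection from them. The projections $\tilde R\to\mathbf{BoolAlg}^{op}$ and $\tilde S\to\mathbf{Top}$ are equivalences of categories, under which $\tilde Z$ and $\tilde W$ are the Stone spectrum functor and the clopen functor, and the reflection is the Stone adjunction $X\mapsto X_{cl}\;\dashv\;B\mapsto X_B$, whose bijection $\mathbf{BoolAlg}(B,X_{cl})\cong\mathbf{Top}(X,X_B)$ sends $h$ to $x\mapsto\{b: x\in h(b)\}$, and whose counit is an isomorphism. (b) *Alexandrov coreflection.* Let $I:\mathbf{Preord}\to\mathcal U$ send a preorder $P$ to $[P,\mathbf{Set}]$ paired with the points given by evaluation at the elements of $P$, and act on monotone maps by the induced geometric morphisms. Let $f(P)=A_P$ be $P$ with the Alexandrov topology (opens = upper sets) and $g(X)=X_\le$ the specialization preorder ($x\le y$ iff every open set containing $x$ contains $y$). There are data for the dual form of the method in the functional case consisting of isomorphisms $\alpha_P:J(A_P)\to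 I(P)$ and arrows $\beta_X:I(X_\le)\to J(X)$, all with the identity as function on indices. The method generates a (co)reflection from them. The projections $\tilde R\to\mathbf{Preord}^{op}$ and $\tilde S\to\mathbf{Top}^{op}$ are equivalences, under which $\tilde Z$ and $\tilde W$ are the opposites of the Alexandrov and specialization functors, and the result is (the opposite of) the Alexandrov coreflection $P\mapsto A_P\;\dashv\;X\mapsto X_\le$, whose bijection $\mathbf{Top}(A_P,X)\cong\mathbf{Preord}(P,X_\le)$ is the identity on underlying functions, and whose unit is an isomorphism. -/

import Mathlib

universe u v₁ v₂ v₃ u₁ u₂ u₃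

namespace StoneAlexandrov

open CategoryTheory CategoryTheory.Limits Opposite

noncomputable section

section Geometric

/-- A geometric morphism from `E` to `F`: an adjoint pair whose left adjoint `inv : F ⥤ E`
preserves finite limits. -/
structure GeomMorph (E F : Type (u + 1)) [Category.{u} E] [Category.{u} F] where
  inv : F ⥤ E
  dir : E ⥤ F
  adj : inv ⊣ dir
  lex : PreservesFiniteLimits inv

namespace GeomMorph

variable {E F G : Type (u + 1)} [Category.{u} E] [Category.{u} F] [Category.{u} G]

/-- The identity geometric morphism. -/
def id (E : Type (u + 1)) [Category.{u} E] : GeomMorph E E where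
  inv := 𝟭 E
  dir := 𝟭 E
  adj := Adjunction.id
  lex := inferInstance

/-- The composite `E → F → G`. -/
def comp (f : GeomMorph E F) (g : GeomMorph F G) : GeomMorph E G where
  inv := g.inv ⋙ f.inv
  dir := f.dir ⋙ g.dir
  adj := g.adj.comp f.adj
  lex :=
    have := f.lex
    have := g.lex
    comp_preservesFiniteLimits g.inv f.inv

/-- Two geometric morphisms are identified when their inverse images are naturally isomorphic. -/
instance setoid (E F : Type (u + 1)) [Category.{u} E] [Category.{u} F] :
    Setoid (GeomMorph E F) where
  r f g := Nonempty (f.inv ≅ g.inv)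
  iseqv :=
    { refl := fun _ => ⟨Iso.refl _⟩
      symm := fun ⟨e⟩ => ⟨e.symm⟩
      trans := fun ⟨e⟩ ⟨e'⟩ => ⟨e ≪≫ e'⟩ }

lemma equiv_of_dir {f g : GeomMorph E F} (e : f.dir ≅ g.dir) : f ≈ g :=
  ⟨((conjugateIsoEquiv f.adj g.adj).symm e).symm⟩

end GeomMorph

/-- Isomorphism classes of geometric morphisms. -/
def GeomClass (E F : Type (u + 1)) [Category.{u} E] [Category.{u} F] : Type (u + 1) :=
  Quotient (GeomMorph.setoid E F)

namespace GeomClass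

variable {E F G H : Type (u + 1)} [Category.{u} E] [Category.{u} F] [Category.{u} G]
  [Category.{u} H]

/-- The isomorphism class of a geometric morphism. -/
def mk (f : GeomMorph E F) : GeomClass E F := Quotient.mk _ f

lemma mk_eq_of_inv {f g : GeomMorph E F} (e : f.inv ≅ g.inv) : mk f = mk g :=
  Quotient.sound ⟨e⟩

lemma mk_eq_of_dir {f g : GeomMorph E F} (e : f.dir ≅ g.dir) : mk f = mk g :=
  Quotient.sound (GeomMorph.equiv_of_dir e)

/-- Composition of isomorphism classes of geometric morphisms `E → F → G`. -/
def comp (f : GeomClass E F) (g : GeomClass F G) : GeomClass E G :=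
  Quotient.map₂ GeomMorph.comp
    (by
      rintro f f' ⟨e⟩ g g' ⟨e'⟩
      exact ⟨Functor.isoWhiskerRight e' f.inv ≪≫ Functor.isoWhiskerLeft g'.inv e⟩) f g

lemma mk_comp_mk (f : GeomMorph E F) (g : GeomMorph F G) :
    (mk f).comp (mk g) = mk (f.comp g) := rfl

lemma id_comp (f : GeomClass E F) : (mk (GeomMorph.id E)).comp f = f := by
  induction f using Quotient.inductionOn with | _ f => exact mk_eq_of_inv (Iso.refl _)

lemma comp_id (f : GeomClass E F) : f.comp (mk (GeomMorph.id F)) = f := by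
  induction f using Quotient.inductionOn with | _ f => exact mk_eq_of_inv (Iso.refl _)

lemma assoc (f : GeomClass E F) (g : GeomClass F G) (h : GeomClass G H) :
    (f.comp g).comp h = f.comp (g.comp h) := by
  induction f using Quotient.inductionOn with | _ f
  induction g using Quotient.inductionOn with | _ g
  induction h using Quotient.inductionOn with | _ h
  exact mk_eq_of_inv (Iso.refl _)

end GeomClass

/-- Points of a topos `E`, up to isomorphism: isomorphism classes of geometric morphisms
from the topos of sets to `E`. -/
abbrev PointClass (E : Type (u + 1)) [Category.{u} E] : Type (u + 1) := GeomClass (Type u) E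

/-- `E` is a Grothendieck topos: it is equivalent to the category of sheaves of sets on a
small site. -/
def IsGrothendieckTopos (E : Type (u + 1)) [Category.{u} E] : Prop :=
  ∃ (C : Type u) (_ : SmallCategory C) (J : GrothendieckTopology C),
    Nonempty (E ≌ Sheaf J (Type u))

/-- A topos paired with points: a Grothendieck topos together with a family of points of it
(up to isomorphism), indexed by a set. -/
structure PointedTopos : Type (u + 2) where
  topos : Type (u + 1)
  [cat : Category.{u} topos]
  isTopos : IsGrothendieckTopos topos
  Index : Type u
  pt : Index → PointClass topos

attribute [instance] PointedTopos.cat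

namespace PointedTopos

/-- An arrow of toposes paired with points: a geometric morphism (up to isomorphism) together
with a function between the indexing sets, such that composing the `x`-th point with the
geometric morphism is the point with index the image of `x`. -/
@[ext]
structure Hom (P Q : PointedTopos.{u}) where
  geom : GeomClass P.topos Q.topos
  index : P.Index → Q.Index
  comm : ∀ x, (P.pt x).comp geom = Q.pt (index x)

instance : Category PointedTopos.{u} where
  Hom := Hom
  id P := ⟨GeomClass.mk (GeomMorph.id _), fun x => x, fun _ => GeomClass.comp_id _⟩
  comp f g := ⟨f.geom.comp g.geom, fun x => g.index (f.index x), fun x => by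
    rw [← GeomClass.assoc, f.comm, g.comm]⟩
  id_comp f := Hom.ext (GeomClass.id_comp _) rfl
  comp_id f := Hom.ext (GeomClass.comp_id _) rfl
  assoc f g h := Hom.ext (GeomClass.assoc _ _ _) rfl

/-- A Grothendieck topos with only a set of points up to isomorphism, paired with all its
points. The index set is a small model of the set of all isomorphism classes of points. -/
def allPoints (E : Type (u + 1)) [Category.{u} E] [Small.{u} (PointClass E)]
    (h : IsGrothendieckTopos E) : PointedTopos.{u} where
  topos := E
  isTopos := h
  Index := Shrink.{u} (PointClass E)
  pt := (equivShrink (PointClass E)).symm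

variable {E F G : Type (u + 1)} [Category.{u} E] [Category.{u} F] [Category.{u} G]
  [Small.{u} (PointClass E)] [Small.{u} (PointClass F)] [Small.{u} (PointClass G)]
  {hE : IsGrothendieckTopos E} {hF : IsGrothendieckTopos F} {hG : IsGrothendieckTopos G}

/-- A geometric morphism between toposes paired with all their points acts on the points by
composition. -/
def ofGeom (γ : GeomClass E F) : allPoints E hE ⟶ allPoints F hF where
  geom := γ
  index x := equivShrink _ (((equivShrink (PointClass E)).symm x).comp γ)
  comm _ := (Equiv.symm_apply_apply _ _).symm

lemma ofGeom_id : ofGeom (hE := hE) (hF := hE) (GeomClass.mk (GeomMorph.id E)) = 𝟙 _ :=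
  Hom.ext rfl (funext fun (x : Shrink.{u} (PointClass E)) =>
    (congrArg (equivShrink (PointClass E)) (GeomClass.comp_id _)).trans
      (Equiv.apply_symm_apply _ x))

lemma ofGeom_comp (γ : GeomClass E F) (δ : GeomClass F G) :
    ofGeom (hE := hE) (hF := hG) (γ.comp δ) = ofGeom (hF := hF) γ ≫ ofGeom δ :=
  Hom.ext rfl (funext fun (_ : Shrink.{u} (PointClass E)) =>
    congrArg (equivShrink (PointClass G)) ((GeomClass.assoc _ γ δ).symm.trans
      (congrArg (fun p : PointClass F => p.comp δ) (Equiv.symm_apply_apply _ _).symm)))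

end PointedTopos

section Sites

variable {C D : Type u} [SmallCategory C] [SmallCategory D]

lemma isGrothendieckTopos_sheaf (J : GrothendieckTopology C) :
    IsGrothendieckTopos (Sheaf J (Type u)) := ⟨C, _, J, ⟨.refl⟩⟩

/-- The geometric morphism `Sh(D, K) → Sh(C, J)` induced by a morphism of sites `C ⥤ D`. -/
def GeomMorph.ofSite (G : C ⥤ D) (J : GrothendieckTopology C) (K : GrothendieckTopology D)
    [G.IsContinuous J K] [RepresentablyFlat G] :
    GeomMorph (Sheaf K (Type u)) (Sheaf J (Type u)) where
  inv := G.sheafPullback (Type u) J K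
  dir := G.sheafPushforwardContinuous (Type u) J K
  adj := G.sheafAdjunctionContinuous (Type u) J K
  lex :=
    have : PreservesFiniteLimits (G.op.lan : (Cᵒᵖ ⥤ Type u) ⥤ (Dᵒᵖ ⥤ Type u)) :=
      lan_preservesFiniteLimits_of_flat _ G
    Functor.sheafPullbackConstruction.preservesFiniteLimits G (Type u) J K

/-- The point of `Sh(C, J)` given by a point of the site `(C, J)`: its inverse image takes the
fibre (stalk) of a sheaf. -/
def GeomMorph.ofPoint {J : GrothendieckTopology C} (Φ : GrothendieckTopology.Point.{u} J) :
    GeomMorph (Type u) (Sheaf J (Type u)) where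
  inv := Φ.sheafFiber
  dir := Φ.skyscraperSheafFunctor
  adj := Φ.skyscraperSheafAdjunction
  lex := inferInstance

end Sites

end Geometric

section Spaces

/-- The object part: a space `X` is sent to the topos of sheaves on `X`, with the points of it
given by the elements of `X`. -/
def spaceObj (X : TopCat.{u}) : PointedTopos.{u} where
  topos := Sheaf (Opens.grothendieckTopology X) (Type u)
  isTopos := isGrothendieckTopos_sheaf _
  Index := X
  pt x := GeomClass.mk (GeomMorph.ofPoint (Opens.pointGrothendieckTopology x))

/-- The functor from topological spaces to toposes paired with points, sending a space `X` to
the topos of sheaves on `X` with the points given by the elements of `X`, and a continuous map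
to the induced geometric morphism. -/
def spaceFunctor : TopCat.{u} ⥤ PointedTopos.{u} where
  obj := spaceObj
  map {X Y} f :=
    { geom := GeomClass.mk (GeomMorph.ofSite (TopologicalSpace.Opens.map f)
        (Opens.grothendieckTopology Y) (Opens.grothendieckTopology X))
      index := fun x => f x
      comm := fun _ => GeomClass.mk_eq_of_dir (Iso.refl _) }
  map_id _ := PointedTopos.Hom.ext (GeomClass.mk_eq_of_dir (Iso.refl _)) rfl
  map_comp _ _ := PointedTopos.Hom.ext (GeomClass.mk_eq_of_dir (Iso.refl _)) rfl

end Spaces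

section Preorders

/-- The functor from preorders to toposes paired with points, sending a preorder `P` to the
topos of functors `P ⥤ Type` with the points given by evaluation at the elements of `P`,
and a monotone map to the induced geometric morphism, whose inverse image is
precomposition. -/
def preordFunctor : Preord.{u} ⥤ PointedTopos.{u} where
  obj P :=
    { topos := P ⥤ Type u
      isTopos := ⟨Pᵒᵖ, inferInstance, ⊥,
        ⟨(opOpEquivalence P).symm.congrLeft.trans (sheafBotEquivalence (Type u)).symm⟩⟩
      Index := P
      pt := fun p => GeomClass.mk
        { inv := (evaluation P (Type u)).obj p
          dir := evaluationRightAdjoint (Type u) p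
          adj := evaluationAdjunctionLeft (Type u) p
          lex := inferInstance } }
  map {P Q} f :=
    { geom := GeomClass.mk
        { inv := (Functor.whiskeringLeft P Q (Type u)).obj f.hom.monotone.functor
          dir := f.hom.monotone.functor.ran
          adj := f.hom.monotone.functor.ranAdjunction (Type u)
          lex := inferInstance }
      index := fun p => f p
      comm := fun _ => GeomClass.mk_eq_of_inv (Iso.refl _) }
  map_id _ := PointedTopos.Hom.ext (GeomClass.mk_eq_of_inv (Iso.refl _)) rfl
  map_comp _ _ := PointedTopos.Hom.ext (GeomClass.mk_eq_of_inv (Iso.refl _)) rfl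

end Preorders

section BooleanAlgebras

/-- The coherent (finite cover) topology on a Boolean algebra `B`: a sieve covers `b` when it
contains finitely many elements whose join is `b`. -/
def coherentTop (B : Type u) [BooleanAlgebra B] : GrothendieckTopology B where
  sieves b := {S | ∃ t : Finset B, (∀ a ∈ t, ∃ f : a ⟶ b, S f) ∧ t.sup _root_.id = b}
  top_mem' b := ⟨{b}, fun a ha => ⟨eqToHom (Finset.mem_singleton.1 ha), trivial⟩, by simp⟩
  pullback_stable' := by
    classical
    rintro b c S f ⟨t, ht, hb⟩
    refine ⟨t.image (c ⊓ ·), ?_, ?_⟩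
    · intro a ha
      obtain ⟨d, hd, rfl⟩ := Finset.mem_image.1 ha
      obtain ⟨g, hg⟩ := ht d hd
      refine ⟨homOfLE inf_le_left, ?_⟩
      have hS := S.downward_closed hg (homOfLE (inf_le_right : c ⊓ d ≤ d))
      rwa [Subsingleton.elim (homOfLE (inf_le_right : c ⊓ d ≤ d) ≫ g)
        (homOfLE (inf_le_left : c ⊓ d ≤ c) ≫ f)] at hS
    · have h : c ≤ t.sup _root_.id := hb ▸ f.le
      rw [Finset.sup_image]
      exact (Finset.sup_inf_distrib_left t _root_.id c).symm.trans (inf_eq_left.2 h)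
  transitive' := by
    classical
    rintro b S ⟨t, ht, hb⟩ R hR
    have key : ∀ a ∈ t, ∃ s : Finset B, (∀ c ∈ s, ∃ f : c ⟶ b, R f) ∧ s.sup _root_.id = a := by
      intro a ha
      obtain ⟨f, hf⟩ := ht a ha
      obtain ⟨s, hs, hsa⟩ := hR hf
      exact ⟨s, fun c hc => (hs c hc).elim fun g hg => ⟨g ≫ f, hg⟩, hsa⟩
    choose! s hs hsa using key
    refine ⟨t.biUnion s, ?_, ?_⟩
    · intro c hc
      obtain ⟨a, ha, hc⟩ := Finset.mem_biUnion.1 hc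
      exact hs a ha c hc
    · rw [Finset.sup_biUnion, ← hb]
      exact Finset.sup_congr rfl hsa

variable {A B : Type u} [BooleanAlgebra A] [BooleanAlgebra B]

lemma homFunctor_flat (h : BoundedLatticeHom A B) :
    RepresentablyFlat (OrderHomClass.mono h : Monotone h).functor where
  cofiltered b :=
    { nonempty := ⟨StructuredArrow.mk (Y := (⊤ : A)) (homOfLE (by simp))⟩
      cone_objs := fun X Y =>
        ⟨StructuredArrow.mk (Y := X.right ⊓ Y.right)
            (homOfLE (by simpa using ⟨X.hom.le, Y.hom.le⟩)),
          StructuredArrow.homMk (homOfLE inf_le_left) (Subsingleton.elim _ _),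
          StructuredArrow.homMk (homOfLE inf_le_right) (Subsingleton.elim _ _), trivial⟩
      cone_maps := fun X Y f g =>
        ⟨X, 𝟙 X, by congr 1; ext; exact Subsingleton.elim _ _⟩ }

lemma homFunctor_continuous (h : BoundedLatticeHom A B) :
    (OrderHomClass.mono h : Monotone h).functor.IsContinuous (coherentTop A) (coherentTop B) := by
  classical
  have := homFunctor_flat h
  refine Functor.isContinuous_of_coverPreserving (compatiblePreservingOfFlat _ _) ⟨?_⟩
  rintro a S ⟨t, ht, rfl⟩
  refine ⟨t.image h, ?_, ?_⟩
  · intro b hb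
    obtain ⟨c, hc, rfl⟩ := Finset.mem_image.1 hb
    obtain ⟨f, hf⟩ := ht c hc
    exact ⟨homOfLE (OrderHomClass.mono h f.le), c, f, 𝟙 _, hf, Subsingleton.elim _ _⟩
  · rw [Finset.sup_image]
    exact (map_finset_sup h t _root_.id).symm

/-- The sheaf on `B` represented by `b`. -/
def repSheaf (b : B) : Sheaf (coherentTop B) (Type u) :=
  (presheafToSheaf (coherentTop B) (Type u)).obj (yoneda.obj b)

/-- The point `p` of `Sh(B)` belongs to the open subtopos given by `b`: its inverse image sends
the subterminal sheaf represented by `b` to a nonempty set. -/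
def PointClass.Holds (p : PointClass (Sheaf (coherentTop B) (Type u))) (b : B) : Prop :=
  Quotient.lift (fun q : GeomMorph (Type u) (Sheaf (coherentTop B) (Type u)) =>
    Nonempty (q.inv.obj (repSheaf b))) (by
      rintro q r ⟨e⟩
      exact propext (e.app (repSheaf b)).toEquiv.nonempty_congr) p

/-- The restriction to presheaves of the inverse image of a point. -/
def presheafInv (q : GeomMorph (Type u) (Sheaf (coherentTop B) (Type u))) :
    (Bᵒᵖ ⥤ Type u) ⥤ Type u := presheafToSheaf (coherentTop B) (Type u) ⋙ q.inv

lemma presheafInv_subsingleton (q : GeomMorph (Type u) (Sheaf (coherentTop B) (Type u)))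
    (b : B) : Subsingleton ((presheafInv q).obj (yoneda.obj b)) := by
  have := q.lex
  have : PreservesFiniteLimits (presheafInv q) := comp_preservesFiniteLimits _ _
  have hs : ∀ c, Subsingleton ((yoneda.obj b : Bᵒᵖ ⥤ Type u).obj c) := fun c =>
    inferInstanceAs (Subsingleton (c.unop ⟶ b))
  have hm : Mono (terminal.from (yoneda.obj b : Bᵒᵖ ⥤ Type u)) :=
    ⟨fun f g _ => by ext c x; exact (hs c).elim _ _⟩
  have h1 : Mono ((presheafInv q).map (terminal.from (yoneda.obj b : Bᵒᵖ ⥤ Type u))) :=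
    inferInstance
  have h2 := IsTerminal.isTerminalObj (presheafInv q) _
    (terminalIsTerminal (C := Bᵒᵖ ⥤ Type u))
  refine ⟨fun x y => (mono_iff_injective _).1 h1 ?_⟩
  exact ((Types.isTerminalEquivUnique _) h2).instSubsingleton.elim _ _

lemma PointClass.holds_injective :
    Function.Injective (PointClass.Holds : PointClass (Sheaf (coherentTop B) (Type u)) → B → Prop) := by
  intro p q hpq
  induction p using Quotient.inductionOn with | _ p
  induction q using Quotient.inductionOn with | _ q
  have h : ∀ b, Nonempty ((presheafInv p).obj (yoneda.obj b)) ↔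
      Nonempty ((presheafInv q).obj (yoneda.obj b)) := fun b => iff_of_eq (congrFun hpq b)
  have sp := presheafInv_subsingleton p
  have sq := presheafInv_subsingleton q
  have hp : (presheafInv p).IsLeftAdjoint :=
    ((sheafificationAdjunction _ _).comp p.adj).isLeftAdjoint
  have hq : (presheafInv q).IsLeftAdjoint :=
    ((sheafificationAdjunction _ _).comp q.adj).isLeftAdjoint
  let e : (yoneda : B ⥤ _) ⋙ presheafInv p ≅ yoneda ⋙ presheafInv q :=
    NatIso.ofComponents (fun b =>
      { hom := ↾fun x => ((h b).1 ⟨x⟩).some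
        inv := ↾fun x => ((h b).2 ⟨x⟩).some
        hom_inv_id := by ext x; exact (sp b).elim _ _
        inv_hom_id := by ext x; exact (sq b).elim _ _ })
      (fun {b c} _ => by ext x; exact (sq c).elim _ _)
  let e' := Functor.isoWhiskerRight (uliftYonedaIsoYoneda.{u} (C := B)) (presheafInv p) ≪≫ e ≪≫
    Functor.isoWhiskerRight (uliftYonedaIsoYoneda.{u} (C := B)).symm (presheafInv q)
  let k : presheafInv p ≅ presheafInv q :=
    Presheaf.uniqueExtensionAlongULiftYoneda.{u} _ (Iso.refl _) ≪≫
      (Presheaf.uniqueExtensionAlongULiftYoneda.{u} _ e').symm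
  let c := asIso (sheafificationAdjunction (coherentTop B) (Type u)).counit
  exact GeomClass.mk_eq_of_inv
    ((Functor.isoWhiskerRight c p.inv).symm ≪≫
      Functor.isoWhiskerLeft (sheafToPresheaf _ _) k ≪≫ Functor.isoWhiskerRight c q.inv)

instance : Small.{u} (PointClass (Sheaf (coherentTop B) (Type u))) :=
  small_of_injective PointClass.holds_injective

/-- The geometric morphism `Sh(B) → Sh(A)` induced by a homomorphism `A → B`, up to
isomorphism. -/
def homGeom (h : BoundedLatticeHom A B) :
    GeomClass (Sheaf (coherentTop B) (Type u)) (Sheaf (coherentTop A) (Type u)) :=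
  have := homFunctor_flat h
  have := homFunctor_continuous h
  GeomClass.mk (GeomMorph.ofSite (OrderHomClass.mono h : Monotone h).functor
    (coherentTop A) (coherentTop B))

lemma homGeom_id : homGeom (BoundedLatticeHom.id A) = GeomClass.mk (GeomMorph.id _) :=
  GeomClass.mk_eq_of_dir (Iso.refl _)

lemma homGeom_comp {C : Type u} [BooleanAlgebra C] (h : BoundedLatticeHom A B)
    (k : BoundedLatticeHom B C) : homGeom (k.comp h) = (homGeom k).comp (homGeom h) :=
  GeomClass.mk_eq_of_dir (Iso.refl _)

/-- The functor from the opposite of the category of Boolean algebras to toposes paired with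
points, sending a Boolean algebra `B` to the topos of sheaves on `B` for the coherent topology
with all its points, and a homomorphism to the induced geometric morphism. -/
def boolAlgFunctor : BoolAlg.{u}ᵒᵖ ⥤ PointedTopos.{u} where
  obj B := PointedTopos.allPoints (Sheaf (coherentTop B.unop) (Type u))
    (isGrothendieckTopos_sheaf _)
  map f := PointedTopos.ofGeom (homGeom f.unop.hom)
  map_id _ := (congrArg PointedTopos.ofGeom homGeom_id).trans PointedTopos.ofGeom_id
  map_comp f g := (congrArg PointedTopos.ofGeom (homGeom_comp g.unop.hom f.unop.hom)).trans
    (PointedTopos.ofGeom_comp (homGeom f.unop.hom) (homGeom g.unop.hom))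

end BooleanAlgebras

section StoneAndAlexandrov

/-- The Stone spectrum of a Boolean algebra: the set of its two-valued homomorphisms
(equivalently, of its ultrafilters). -/
def StoneSpace (B : Type u) [BooleanAlgebra B] : Type u := BoundedLatticeHom B Bool

/-- The homomorphism underlying an element of the Stone spectrum. -/
def StoneSpace.toHom {B : Type u} [BooleanAlgebra B] (φ : StoneSpace B) :
    BoundedLatticeHom B Bool := φ

/-- The Stone topology: it is generated by the sets of homomorphisms taking the value `true` at
a given element. -/
instance (B : Type u) [BooleanAlgebra B] : TopologicalSpace (StoneSpace B) :=
  TopologicalSpace.generateFrom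
    {s | ∃ b : B, s = {φ : StoneSpace B | φ.toHom b = true}}

/-- The functor sending a Boolean algebra to its Stone spectrum, acting on homomorphisms by
composition. -/
def stoneSpectrum : BoolAlg.{u}ᵒᵖ ⥤ TopCat.{u} where
  obj B := TopCat.of (StoneSpace B.unop)
  map {A B} h := TopCat.ofHom
    { toFun := fun φ : StoneSpace A.unop => (φ.toHom.comp h.unop.hom : StoneSpace B.unop)
      continuous_toFun := continuous_generateFrom_iff.2 (by
        rintro _ ⟨b, rfl⟩
        exact TopologicalSpace.isOpen_generateFrom_of_mem ⟨h.unop.hom b, rfl⟩) }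

/-- The functor sending a space to (the opposite of) the Boolean algebra of its clopen subsets,
acting on continuous maps by inverse image. -/
def clopenAlgebra : TopCat.{u} ⥤ BoolAlg.{u}ᵒᵖ where
  obj X := op (BoolAlg.of (TopologicalSpace.Clopens X))
  map f := (BoolAlg.ofHom
    { toFun := fun V => ⟨f ⁻¹' V, V.isClopen.preimage f.hom.continuous⟩
      map_sup' := fun _ _ => rfl
      map_inf' := fun _ _ => rfl
      map_top' := rfl
      map_bot' := rfl }).op

/-- The functor sending a preorder `P` to the Alexandrov space on `P`, whose open sets are the
upper sets of `P`. -/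
def alexandrov : Preord.{u} ⥤ TopCat.{u} where
  obj P := TopCat.of (Topology.WithUpperSet P)
  map f := TopCat.ofHom (Topology.WithUpperSet.map f.hom)

/-- The functor sending a space `X` to its specialization preorder: `x ≤ y` when every open set
containing `x` contains `y`. -/
def specialization : TopCat.{u} ⥤ Preord.{u} := topToPreord

end StoneAndAlexandrov

end

/-! The general method for generating reflections. -/

section Method

variable {H : Type u₁} {K : Type u₂} {U : Type u₃} [Category.{v₁} H] [Category.{v₂} K]
  [Category.{v₃} U]

/-- The data and hypotheses of the general method, for functors `I : H ⥤ U` and `J : K ⥤ U`: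
relations `R` and `S` between the objects of `H` and those of `K`, arrows `ξ` and `χ` of `U`
over them, a map `Z` from pairs in `R` to pairs in `S` keeping the second component, and a map
`W` from pairs in `S` to pairs in `R` keeping the first component. `Z h` denotes the first
component of the image of a pair under `Z`, and `W h` the second component of the image under
`W`. -/
structure MethodData (I : H ⥤ U) (J : K ⥤ U) where
  R : H → K → Prop
  S : H → K → Prop
  ξ {C : H} {D : K} (h : R C D) : I.obj C ⟶ J.obj D
  χ {C : H} {D : K} (h : S C D) : J.obj D ⟶ I.obj C
  Z {C : H} {D : K} (h : R C D) : H
  Z_rel {C : H} {D : K} (h : R C D) : S (Z h) D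
  W {C : H} {D : K} (h : S C D) : K
  W_rel {C : H} {D : K} (h : S C D) : R C (W h)
  ε {C : H} {D : K} (h : R C D) : Z h ≅ C
  ξ_χ {C : H} {D : K} (h : R C D) : ξ h ≫ χ (Z_rel h) = I.map (ε h).inv
  η {C : H} {D : K} (h : S C D) : D ⟶ W h
  χ_ξ {C : H} {D : K} (h : S C D) : χ h ≫ ξ (W_rel h) = J.map (η h)
  isIso_ξ {C : H} {D : K} (h : R C D) : IsIso (ξ h)
  isIso_η {C : H} {D : K} (h : R C D) : IsIso (η (Z_rel h))

namespace MethodData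

variable {I : H ⥤ U} {J : K ⥤ U} (M : MethodData I J)

/-- The objects of the category `R̃`: the pairs in `R`. -/
structure RCat where
  left : H
  right : K
  rel : M.R left right

/-- The objects of the category `S̃`: the pairs in `S`. -/
structure SCat where
  left : H
  right : K
  rel : M.S left right

variable {M}

/-- The arrows of `R̃`: the pairs of arrows compatible with `ξ`. -/
@[ext]
structure RHom (X Y : M.RCat) where
  u : X.left ⟶ Y.left
  v : X.right ⟶ Y.right
  comm : I.map u ≫ M.ξ Y.rel = M.ξ X.rel ≫ J.map v

/-- The arrows of `S̃`: the triples of arrows compatible with `χ` and `ξ`. -/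
@[ext]
structure SHom (X Y : M.SCat) where
  z : X.left ⟶ Y.left
  v : X.right ⟶ Y.right
  w : M.W X.rel ⟶ M.W Y.rel
  comm_χ : J.map v ≫ M.χ Y.rel = M.χ X.rel ≫ I.map z
  comm_ξ : I.map z ≫ M.ξ (M.W_rel Y.rel) = M.ξ (M.W_rel X.rel) ≫ J.map w

instance : Category M.RCat where
  Hom := RHom
  id X := ⟨𝟙 _, 𝟙 _, by simp⟩
  comp f g := ⟨f.u ≫ g.u, f.v ≫ g.v, by
    rw [I.map_comp, J.map_comp, Category.assoc, g.comm, ← Category.assoc, f.comm,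
      Category.assoc]⟩
  id_comp f := RHom.ext (Category.id_comp _) (Category.id_comp _)
  comp_id f := RHom.ext (Category.comp_id _) (Category.comp_id _)
  assoc f g h := RHom.ext (Category.assoc _ _ _) (Category.assoc _ _ _)

instance : Category M.SCat where
  Hom := SHom
  id X := ⟨𝟙 _, 𝟙 _, 𝟙 _, by simp, by simp⟩
  comp f g := ⟨f.z ≫ g.z, f.v ≫ g.v, f.w ≫ g.w,
    by rw [I.map_comp, J.map_comp, Category.assoc, g.comm_χ, ← Category.assoc, f.comm_χ,
      Category.assoc],
    by rw [I.map_comp, J.map_comp, Category.assoc, g.comm_ξ, ← Category.assoc, f.comm_ξ,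
      Category.assoc]⟩
  id_comp f := SHom.ext (Category.id_comp _) (Category.id_comp _) (Category.id_comp _)
  comp_id f := SHom.ext (Category.comp_id _) (Category.comp_id _) (Category.comp_id _)
  assoc f g h := SHom.ext (Category.assoc _ _ _) (Category.assoc _ _ _) (Category.assoc _ _ _)

variable (M)

/-- The projection `R̃ ⥤ H`. -/
def projH : M.RCat ⥤ H where
  obj X := X.left
  map f := f.u

/-- The projection `S̃ ⥤ K`. -/
def projK : M.SCat ⥤ K where
  obj X := X.right
  map f := f.v

lemma χ_Z {C : H} {D : K} (h : M.R C D) :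
    have := M.isIso_ξ h
    M.χ (M.Z_rel h) = inv (M.ξ h) ≫ I.map (M.ε h).inv := by
  have := M.isIso_ξ h
  simp [← M.ξ_χ h]

lemma isIso_χ_Z {C : H} {D : K} (h : M.R C D) : IsIso (M.χ (M.Z_rel h)) := by
  have := M.isIso_ξ h
  rw [M.χ_Z h]
  infer_instance

/-- The functor `Z̃ : R̃ ⥤ S̃`. An arrow `(u, v)` is sent to `(z, v, w)`, where `z` corresponds
to `u` under the isomorphisms `ε` and `w` corresponds to `v` under the isomorphisms `η`. -/
noncomputable def tildeZ : M.RCat ⥤ M.SCat where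
  obj X := ⟨M.Z X.rel, X.right, M.Z_rel X.rel⟩
  map {X Y} f :=
    have := M.isIso_η X.rel
    have h1 : J.map f.v ≫ M.χ (M.Z_rel Y.rel) =
        M.χ (M.Z_rel X.rel) ≫ I.map ((M.ε X.rel).hom ≫ f.u ≫ (M.ε Y.rel).inv) := by
      have := M.isIso_ξ X.rel
      rw [← cancel_epi (M.ξ X.rel), ← Category.assoc, ← f.comm, Category.assoc, M.ξ_χ,
        ← Category.assoc, M.ξ_χ, ← I.map_comp, ← I.map_comp, Iso.inv_hom_id_assoc]
    { z := (M.ε X.rel).hom ≫ f.u ≫ (M.ε Y.rel).inv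
      v := f.v
      w := inv (M.η (M.Z_rel X.rel)) ≫ f.v ≫ M.η (M.Z_rel Y.rel)
      comm_χ := h1
      comm_ξ := by
        have := M.isIso_χ_Z X.rel
        rw [← cancel_epi (M.χ (M.Z_rel X.rel)), ← Category.assoc, ← h1, Category.assoc, M.χ_ξ,
          ← Category.assoc, M.χ_ξ, ← J.map_comp, ← J.map_comp, IsIso.hom_inv_id_assoc] }
  map_id X := by
    have := M.isIso_η X.rel
    apply SHom.ext
    · change (M.ε X.rel).hom ≫ 𝟙 _ ≫ (M.ε X.rel).inv = 𝟙 _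
      simp
    · rfl
    · change inv (M.η (M.Z_rel X.rel)) ≫ 𝟙 _ ≫ M.η (M.Z_rel X.rel) = 𝟙 _
      simp
  map_comp {X Y Z} f g := by
    have := M.isIso_η X.rel
    have := M.isIso_η Y.rel
    apply SHom.ext
    · change (M.ε X.rel).hom ≫ (f.u ≫ g.u) ≫ (M.ε Z.rel).inv =
        ((M.ε X.rel).hom ≫ f.u ≫ (M.ε Y.rel).inv) ≫ (M.ε Y.rel).hom ≫ g.u ≫ (M.ε Z.rel).inv
      simp
    · rfl
    · change inv (M.η (M.Z_rel X.rel)) ≫ (f.v ≫ g.v) ≫ M.η (M.Z_rel Z.rel) =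
        (inv (M.η (M.Z_rel X.rel)) ≫ f.v ≫ M.η (M.Z_rel Y.rel)) ≫
          inv (M.η (M.Z_rel Y.rel)) ≫ g.v ≫ M.η (M.Z_rel Z.rel)
      simp

/-- The functor `W̃ : S̃ ⥤ R̃`, sending an arrow `(z, v, w)` to `(z, w)`. -/
def tildeW : M.SCat ⥤ M.RCat where
  obj X := ⟨X.left, M.W X.rel, M.W_rel X.rel⟩
  map f := ⟨f.z, f.w, f.comm_ξ⟩

/-- The unit of the method, with components `ε⁻¹`, `η` and `η`. -/
def unitHom (X : M.SCat) : X ⟶ (M.tildeW ⋙ M.tildeZ).obj X :=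
  SHom.mk (Y := (M.tildeW ⋙ M.tildeZ).obj X) (M.ε (M.W_rel X.rel)).inv (M.η X.rel)
    (M.η (M.Z_rel (M.W_rel X.rel)))
    (by
      change J.map (M.η X.rel) ≫ M.χ (M.Z_rel (M.W_rel X.rel)) =
        M.χ X.rel ≫ I.map (M.ε (M.W_rel X.rel)).inv
      rw [← M.χ_ξ, ← M.ξ_χ, Category.assoc])
    (by
      change I.map (M.ε (M.W_rel X.rel)).inv ≫ M.ξ (M.W_rel (M.Z_rel (M.W_rel X.rel))) =
        M.ξ (M.W_rel X.rel) ≫ J.map (M.η (M.Z_rel (M.W_rel X.rel)))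
      rw [← M.χ_ξ, ← M.ξ_χ, Category.assoc])

/-- The counit of the method, with components `ε` and `η⁻¹`. -/
noncomputable def counitHom (X : M.RCat) : (M.tildeZ ⋙ M.tildeW).obj X ⟶ X :=
  have hη : IsIso (M.η (M.Z_rel X.rel)) := M.isIso_η X.rel
  have h : I.map (M.ε X.rel).hom ≫ M.ξ X.rel =
      M.ξ (M.W_rel (M.Z_rel X.rel)) ≫ J.map (inv (M.η (M.Z_rel X.rel))) := by
    have := M.isIso_ξ X.rel
    have := M.isIso_χ_Z X.rel
    have h' : M.χ (M.Z_rel X.rel) ≫ I.map (M.ε X.rel).hom ≫ M.ξ X.rel = 𝟙 _ := by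
      rw [M.χ_Z]
      simp [← Functor.map_comp_assoc]
    rw [← cancel_epi (M.χ (M.Z_rel X.rel)), h', ← Category.assoc, M.χ_ξ, ← J.map_comp]
    simp
  let k : M.W (M.Z_rel X.rel) ⟶ X.right := inv (M.η (M.Z_rel X.rel))
  RHom.mk (X := (M.tildeZ ⋙ M.tildeW).obj X) (M.ε X.rel).hom k h

/-- The method generates a reflection: `W̃` is left adjoint to `Z̃`, with the unit and counit of
the method, and the counit is an isomorphism. -/
structure Generates (adj : M.tildeW ⊣ M.tildeZ) : Prop where
  unit_eq (X : M.SCat) : adj.unit.app X = M.unitHom X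
  counit_eq (X : M.RCat) : adj.counit.app X = M.counitHom X
  isIso_counit : IsIso adj.counit

end MethodData

/-- The data and hypotheses of the method in the functional case, where the relations are given
by functions `f` and `g` on objects. -/
structure FunctionalData (I : H ⥤ U) (J : K ⥤ U) (f : H → K) (g : K → H) where
  ξ (C : H) : I.obj C ⟶ J.obj (f C)
  χ (D : K) : J.obj D ⟶ I.obj (g D)
  ε (C : H) : g (f C) ≅ C
  ξ_χ (C : H) : ξ C ≫ χ (f C) = I.map (ε C).inv
  η (D : K) : D ⟶ f (g D)
  χ_ξ (D : K) : χ D ≫ ξ (g D) = J.map (η D)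
  isIso_ξ (C : H) : IsIso (ξ C)
  isIso_η (C : H) : IsIso (η (f C))

namespace FunctionalData

variable {I : H ⥤ U} {J : K ⥤ U} {f : H → K} {g : K → H}

/-- The instance of the general method given by functional data: `R` is the graph of `f`, `S` is
the inverse of the graph of `g`, `Z` sends `(C, D)` to `(g D, D)` and `W` sends `(C, D)` to
`(C, f C)`. -/
def toMethodData (Φ : FunctionalData I J f g) : MethodData I J where
  R C D := f C = D
  S C D := g D = C
  ξ {C D} h := Φ.ξ C ≫ J.map (eqToHom h)
  χ {C D} h := Φ.χ D ≫ I.map (eqToHom h)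
  Z {_ D} _ := g D
  Z_rel _ := rfl
  W {C _} _ := f C
  W_rel _ := rfl
  ε {C D} h := eqToIso (congrArg g h.symm) ≪≫ Φ.ε C
  ξ_χ {C D} h := by
    subst h
    simp [Φ.ξ_χ]
  η {C D} h := Φ.η D ≫ eqToHom (congrArg f h)
  χ_ξ {C D} h := by
    subst h
    simp [Φ.χ_ξ]
  isIso_ξ {C D} h := by
    have := Φ.isIso_ξ C
    infer_instance
  isIso_η {C D} h := by
    subst h
    have := Φ.isIso_η C
    infer_instance

/-- The pair `(C, f C)`. -/
def objR (Φ : FunctionalData I J f g) (C : H) : Φ.toMethodData.RCat := ⟨C, f C, rfl⟩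

/-- The pair `(g D, D)`. -/
def objS (Φ : FunctionalData I J f g) (D : K) : Φ.toMethodData.SCat := ⟨g D, D, rfl⟩

/-- The reflection generated by the method from functional data is the adjunction `a`: the
method generates a reflection between `R̃` and `S̃`; the projections `R̃ ⥤ H` and `S̃ ⥤ K` are
equivalences, under which `Z̃` and `W̃` become `F` and `G`, and the unit and counit become those
of `a`. -/
structure Yields {F : H ⥤ K} {G : K ⥤ H} (Φ : FunctionalData I J F.obj G.obj) (a : G ⊣ F) :
    Prop where
  projH_equiv : Φ.toMethodData.projH.IsEquivalence
  projK_equiv : Φ.toMethodData.projK.IsEquivalence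
  tildeZ_eq : Φ.toMethodData.tildeZ ⋙ Φ.toMethodData.projK = Φ.toMethodData.projH ⋙ F
  tildeW_eq : Φ.toMethodData.tildeW ⋙ Φ.toMethodData.projH = Φ.toMethodData.projK ⋙ G
  exists_adj : ∃ adj : Φ.toMethodData.tildeW ⊣ Φ.toMethodData.tildeZ,
    Φ.toMethodData.Generates adj ∧
    (∀ D : K, Φ.toMethodData.projK.map (adj.unit.app (Φ.objS D)) = a.unit.app D) ∧
    (∀ C : H, Φ.toMethodData.projH.map (adj.counit.app (Φ.objR C)) = a.counit.app C)

end FunctionalData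

/-- The data and hypotheses of the dual (coreflection) form of the method in the functional
case. -/
structure CofunctionalData (I : H ⥤ U) (J : K ⥤ U) (f : H → K) (g : K → H) where
  α (C : H) : J.obj (f C) ⟶ I.obj C
  β (D : K) : I.obj (g D) ⟶ J.obj D
  lam (C : H) : g (f C) ≅ C
  β_α (C : H) : β (f C) ≫ α C = I.map (lam C).hom
  mu (D : K) : f (g D) ⟶ D
  α_β (D : K) : α (g D) ≫ β D = J.map (mu D)
  isIso_α (C : H) : IsIso (α C)
  isIso_mu (C : H) : IsIso (mu (f C))

/-- The dual form of the method is the method applied to the opposite categories and functors. -/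
def CofunctionalData.op {I : H ⥤ U} {J : K ⥤ U} {f : H → K} {g : K → H}
    (Φ : CofunctionalData I J f g) :
    FunctionalData I.op J.op (fun C => Opposite.op (f C.unop)) (fun D => Opposite.op (g D.unop))
    where
  ξ C := (Φ.α C.unop).op
  χ D := (Φ.β D.unop).op
  ε C := (Φ.lam C.unop).symm.op
  ξ_χ C := congrArg Quiver.Hom.op (Φ.β_α C.unop)
  η D := (Φ.mu D.unop).op
  χ_ξ D := congrArg Quiver.Hom.op (Φ.α_β D.unop)
  isIso_ξ C := by
    have := Φ.isIso_α C.unop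
    infer_instance
  isIso_η C := by
    have := Φ.isIso_mu C.unop
    infer_instance

end Method

end StoneAlexandrov

open CategoryTheory StoneAlexandrov

/-! Both halves follow one pattern. Let `G ⊣ F` have an invertible counit and let `I ≅ F ⋙ J` be a
natural isomorphism `ξ`. With `η` the unit, `ε` the counit and `χ = J(η) ≫ ξ⁻¹`, the equations of
the method are a triangle identity and the naturality of `ξ`. Here `J` is faithful, since an arrow
between spaces is determined by its index function. Hence an arrow `(u, v)` of R̃ satisfies `v = F
u`, and an arrow `(z, v, w)` of S̃ satisfies `z = G v` and `w = F z`, up to equality transports. So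
the projections are equivalences and the generated adjunction is the given one
(`FunctionalData.yields`). The Alexandrov case is the same argument in the opposite categories.

What remains is each natural isomorphism, obtained from the comparison lemma for dense subsites. For
a Boolean algebra `B`, the basic opens form a basis of the Stone spectrum, and the prime ideal
theorem shows that they cover a basic open exactly when finitely many of them have the right join;
so the spectrum has the same sheaves as `B`. A point of this topos is determined by the elements
holding at it, and these form a prime filter, so the points also agree.

For a preorder `P`, every `p` has a smallest open neighbourhood, which only the maximal sieve
covers. Sheaves on the Alexandrov space are thus presheaves on `Pᵒᵖ`, that is, functors on `P`.
Naturality is less direct here, as one topos is described by inverse images and the other by direct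
images; `alexandrovAdjunction` links the two. -/

namespace StoneAlexandrov

open CategoryTheory.Limits Opposite TopologicalSpace

/-! ### Reflections generated from an adjunction -/

namespace MethodData

variable {H : Type u₁} {K : Type u₂} {U : Type u₃} [Category.{v₁} H] [Category.{v₂} K]
  [Category.{v₃} U] {I : H ⥤ U} {J : K ⥤ U} (M : MethodData I J)

/-- `J` turns `η` into `χ ≫ ξ`, so the square is the pasting of the two squares that define an arrow
of S̃. -/
lemma comp_η [J.Faithful] {X Y : M.SCat} (f : X ⟶ Y) :
    f.v ≫ M.η Y.rel = M.η X.rel ≫ f.w := by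
  apply J.map_injective
  rw [J.map_comp, J.map_comp, ← M.χ_ξ, ← M.χ_ξ, Category.assoc, ← f.comm_ξ, ← Category.assoc,
    f.comm_χ, Category.assoc]

/-- The adjunction generated by the method when arrows of `R̃` and of `S̃` are determined by their
components in `H` and in `K`. -/
noncomputable def adjunction [J.Faithful] [M.projH.Faithful] [M.projK.Faithful] :
    M.tildeW ⊣ M.tildeZ :=
  -- Faithfulness of the projections lets each identity be checked in one component: in `K` for
  -- arrows of S̃, where it concerns `η`, and in `H` for arrows of R̃, where it concerns `ε`.
  Adjunction.mkOfUnitCounit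
    { unit :=
        { app := M.unitHom
          naturality := fun _ _ f => M.projK.map_injective (M.comp_η f) }
      counit :=
        { app := M.counitHom
          naturality := fun X Y f => M.projH.map_injective (by
            change ((M.ε X.rel).hom ≫ f.u ≫ (M.ε Y.rel).inv) ≫ (M.ε Y.rel).hom =
              (M.ε X.rel).hom ≫ f.u
            simp) }
      left_triangle := by
        ext X
        apply M.projH.map_injective
        change (M.ε (M.W_rel X.rel)).inv ≫ 𝟙 _ ≫ (M.ε (M.W_rel X.rel)).hom = 𝟙 _
        simp
      right_triangle := by
        ext X
        apply M.projK.map_injective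
        have := M.isIso_η X.rel
        change M.η (M.Z_rel X.rel) ≫ 𝟙 _ ≫ inv (M.η (M.Z_rel X.rel)) = 𝟙 _
        simp }

lemma generates [J.Faithful] [M.projH.IsEquivalence] [M.projK.Faithful] :
    M.Generates M.adjunction where
  unit_eq _ := rfl
  counit_eq _ := rfl
  isIso_counit := by
    have (X : M.RCat) : IsIso (M.adjunction.counit.app X) := by
      -- The counit projects to the isomorphism `ε`, and an equivalence reflects isomorphisms.
      have : IsIso (M.projH.map (M.adjunction.counit.app X)) :=
        inferInstanceAs (IsIso (M.ε X.rel).hom)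
      exact isIso_of_reflects_iso _ M.projH
    exact NatIso.isIso_of_isIso_app _

end MethodData

namespace FunctionalData

variable {H : Type u₁} {K : Type u₂} {U : Type u₃} [Category.{v₁} H] [Category.{v₂} K]
  [Category.{v₃} U] {I : H ⥤ U} {J : K ⥤ U} {F : H ⥤ K} {G : K ⥤ H}
  (Φ : FunctionalData I J F.obj G.obj) (a : G ⊣ F)

include a in
-- After composition with the invertible `ξ`, naturality of `χ` becomes naturality of the unit.
lemma comp_χ (hη : ∀ D, Φ.η D = a.unit.app D)
    (hξ : ∀ {C C' : H} (k : C ⟶ C'), I.map k ≫ Φ.ξ C' = Φ.ξ C ≫ J.map (F.map k))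
    {D D' : K} (k : D ⟶ D') : J.map k ≫ Φ.χ D' = Φ.χ D ≫ I.map (G.map k) := by
  have := Φ.isIso_ξ (G.obj D')
  rw [← cancel_mono (Φ.ξ (G.obj D')), Category.assoc, Category.assoc, Φ.χ_ξ, hξ, ← Category.assoc,
    Φ.χ_ξ, hη, hη, ← J.map_comp, ← J.map_comp]
  exact congrArg J.map (a.unit.naturality k)

/-- Naturality and invertibility of `ξ` force `J v = J (F u)`, and `J` is faithful. The transports
are those required to compare functors whose object parts agree only propositionally. -/
lemma v_eq [J.Faithful]
    (hξ : ∀ {C C' : H} (k : C ⟶ C'), I.map k ≫ Φ.ξ C' = Φ.ξ C ≫ J.map (F.map k))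
    {X Y : Φ.toMethodData.RCat} (k : X ⟶ Y) :
    k.v = eqToHom X.rel.symm ≫ F.map k.u ≫ eqToHom Y.rel := by
  obtain ⟨C, _, rfl⟩ := X
  obtain ⟨C', _, rfl⟩ := Y
  have := Φ.isIso_ξ C
  apply J.map_injective
  have h := k.comm
  change I.map k.u ≫ Φ.ξ C' ≫ J.map (𝟙 _) = (Φ.ξ C ≫ J.map (𝟙 _)) ≫ J.map k.v at h
  rw [J.map_id, J.map_id, Category.comp_id, Category.comp_id, hξ, cancel_epi] at h
  simpa using h.symm

include a in
-- Under the adjunction the claim transposes to `η ≫ F z = η ≫ F (G v)`. Since `J` sends `η` to `χ ≫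
-- ξ` and `ξ` is natural, it reduces to the square for `χ`.
lemma z_eq [J.Faithful] (hη : ∀ D, Φ.η D = a.unit.app D)
    (hξ : ∀ {C C' : H} (k : C ⟶ C'), I.map k ≫ Φ.ξ C' = Φ.ξ C ≫ J.map (F.map k))
    {X Y : Φ.toMethodData.SCat} (k : X ⟶ Y) :
    k.z = eqToHom X.rel.symm ≫ G.map k.v ≫ eqToHom Y.rel := by
  obtain ⟨_, D, rfl⟩ := X
  obtain ⟨_, D', rfl⟩ := Y
  suffices h : k.z = G.map k.v by simpa using h
  apply (a.homEquiv _ _).injective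
  rw [a.homEquiv_unit, a.homEquiv_unit]
  apply J.map_injective
  have h := k.comm_χ
  change J.map k.v ≫ Φ.χ D' ≫ I.map (𝟙 _) = (Φ.χ D ≫ I.map (𝟙 _)) ≫ I.map k.z at h
  rw [I.map_id, I.map_id, Category.comp_id, Category.comp_id, Φ.comp_χ a hη hξ] at h
  rw [J.map_comp, J.map_comp, ← hη, ← Φ.χ_ξ, Category.assoc, Category.assoc, ← hξ, ← hξ,
    ← Category.assoc, ← Category.assoc, ← h]

/-- The method yields the adjunction `a` as soon as `ξ` is natural, `η` and `ε` are the unit and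
the counit of `a`, and `J` is faithful. -/
lemma yields [J.Faithful] (hη : ∀ D, Φ.η D = a.unit.app D)
    (hε : ∀ C, (Φ.ε C).hom = a.counit.app C)
    (hξ : ∀ {C C' : H} (k : C ⟶ C'), I.map k ≫ Φ.ξ C' = Φ.ξ C ≫ J.map (F.map k)) :
    Φ.Yields a := by
  have hH : Φ.toMethodData.projH.IsEquivalence :=
    { faithful := ⟨fun {X Y} k l h => by
        have h' : k.u = l.u := h
        exact MethodData.RHom.ext h' (by rw [Φ.v_eq hξ, Φ.v_eq hξ l, h'])⟩
      full := ⟨fun {X Y} k => by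
        obtain ⟨C, _, rfl⟩ := X
        obtain ⟨C', _, rfl⟩ := Y
        change C ⟶ C' at k
        refine ⟨⟨k, F.map k, ?_⟩, rfl⟩
        change I.map k ≫ Φ.ξ C' ≫ J.map (𝟙 _) = (Φ.ξ C ≫ J.map (𝟙 _)) ≫ J.map _
        simpa using hξ k⟩
      essSurj := ⟨fun C => ⟨Φ.objR C, ⟨Iso.refl _⟩⟩⟩ }
  have hK : Φ.toMethodData.projK.IsEquivalence :=
    { faithful := ⟨fun {X Y} k l h => by
        have h' : k.v = l.v := h
        have h'' : k.z = l.z := by rw [Φ.z_eq a hη hξ, Φ.z_eq a hη hξ l, h']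
        refine MethodData.SHom.ext h'' h' ?_
        -- The component `w` is the second component of the image under `tildeW`, so it is
        -- determined by `z`.
        have h₁ := Φ.v_eq hξ (Φ.toMethodData.tildeW.map k)
        have h₂ := Φ.v_eq hξ (Φ.toMethodData.tildeW.map l)
        have h₃ : (Φ.toMethodData.tildeW.map k).u = (Φ.toMethodData.tildeW.map l).u := h''
        rw [h₃] at h₁
        exact h₁.trans h₂.symm⟩
      full := ⟨fun {X Y} k => by
        obtain ⟨_, D, rfl⟩ := X
        obtain ⟨_, D', rfl⟩ := Y
        change D ⟶ D' at k
        refine ⟨⟨G.map k, k, F.map (G.map k), ?_, ?_⟩, rfl⟩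
        · change J.map k ≫ Φ.χ D' ≫ I.map (𝟙 _) = (Φ.χ D ≫ I.map (𝟙 _)) ≫ I.map _
          simpa using Φ.comp_χ a hη hξ k
        · change I.map _ ≫ Φ.ξ _ ≫ J.map (𝟙 _) = (Φ.ξ _ ≫ J.map (𝟙 _)) ≫ J.map _
          simpa using hξ (G.map k)⟩
      essSurj := ⟨fun D => ⟨Φ.objS D, ⟨Iso.refl _⟩⟩⟩ }
  refine ⟨hH, hK, ?_, ?_, Φ.toMethodData.adjunction, Φ.toMethodData.generates, ?_, ?_⟩
  · exact CategoryTheory.Functor.ext (fun X => X.rel.symm) (fun X Y k => Φ.v_eq hξ k)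
  · exact CategoryTheory.Functor.ext (fun X => X.rel.symm) (fun X Y k => Φ.z_eq a hη hξ k)
  · intro D
    change Φ.η D ≫ 𝟙 _ = _
    rw [Category.comp_id, hη]
  · intro C
    change 𝟙 _ ≫ (Φ.ε C).hom = _
    rw [Category.id_comp, hε]

/-- The data for the method given by an adjunction `G ⊣ F` whose counit is an isomorphism and a
natural isomorphism `I ≅ F ⋙ J`. -/
noncomputable def ofAdjunction [IsIso a.counit] (e : I ≅ F ⋙ J) :
    FunctionalData I J F.obj G.obj where
  ξ C := e.hom.app C
  χ D := J.map (a.unit.app D) ≫ e.inv.app (G.obj D)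
  ε C := asIso (a.counit.app C)
  ξ_χ C := by
    -- The triangle identity makes the unit at `F.obj C` the image of `ε⁻¹` under `F`; naturality of
    -- `e` then cancels `e` against its inverse.
    have h : a.unit.app (F.obj C) = F.map (inv (a.counit.app C)) := by
      rw [Functor.map_inv]
      exact (IsIso.inv_eq_of_inv_hom_id (a.right_triangle_components C)).symm
    rw [h]
    exact (e.hom.naturality_assoc (inv (a.counit.app C)) _).symm.trans (by simp)
  η D := a.unit.app D
  χ_ξ D := by simp
  isIso_ξ C := inferInstance
  isIso_η C := by
    have h : a.unit.app (F.obj C) = inv (F.map (a.counit.app C)) :=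
      (IsIso.inv_eq_of_inv_hom_id (a.right_triangle_components C)).symm
    rw [h]
    infer_instance

end FunctionalData

namespace CofunctionalData

variable {H : Type u₁} {K : Type u₂} {U : Type u₃} [Category.{v₁} H] [Category.{v₂} K]
  [Category.{v₃} U] {I : H ⥤ U} {J : K ⥤ U} {F : H ⥤ K} {G : K ⥤ H} (a : F ⊣ G)

/-- The data for the dual form of the method given by an adjunction `F ⊣ G` whose unit is an
isomorphism and a natural isomorphism `F ⋙ J ≅ I`. -/
noncomputable def ofAdjunction [IsIso a.unit] (e : F ⋙ J ≅ I) :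
    CofunctionalData I J F.obj G.obj where
  α C := e.hom.app C
  β D := e.inv.app (G.obj D) ≫ J.map (a.counit.app D)
  lam C := (asIso (a.unit.app C)).symm
  β_α C := by
    have h : a.counit.app (F.obj C) = F.map (inv (a.unit.app C)) := by
      rw [Functor.map_inv]
      exact (IsIso.inv_eq_of_hom_inv_id (a.left_triangle_components C)).symm
    rw [h, Category.assoc]
    exact (congrArg (_ ≫ ·) (e.hom.naturality (inv (a.unit.app C)))).trans (by simp)
  mu D := a.counit.app D
  α_β D := by simp
  isIso_α C := inferInstance
  isIso_mu C := by
    have h : a.counit.app (F.obj C) = inv (F.map (a.unit.app C)) :=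
      (IsIso.inv_eq_of_hom_inv_id (a.left_triangle_components C)).symm
    rw [h]
    infer_instance

/-- The unit and counit of `a.op` are the opposites of the counit and unit of `a`, so the hypotheses
of `FunctionalData.yields` hold by definition and by naturality of `e`. -/
lemma yields_ofAdjunction [J.Faithful] [IsIso a.unit] (e : F ⋙ J ≅ I) :
    (ofAdjunction a e).op.Yields (F := F.op) (G := G.op) a.op :=
  FunctionalData.yields (F := F.op) (G := G.op) _ _ (fun _ => rfl) (fun _ => rfl)
    (fun k => congrArg Quiver.Hom.op (e.hom.naturality k.unop).symm)

end CofunctionalData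

/-- The functor from spaces to toposes paired with points is faithful. -/
instance : spaceFunctor.{u}.Faithful where
  map_injective {X Y f g} h := by
    ext x
    exact congrFun (congrArg PointedTopos.Hom.index h) x

/-! ### Prime filters and the topology of the Stone spectrum -/

namespace StoneSpace

variable {B : Type u} [BooleanAlgebra B]

lemma ext_of_iff {φ ψ : StoneSpace B} (h : ∀ b, φ.toHom b = true ↔ ψ.toHom b = true) : φ = ψ :=
  DFunLike.ext (F := BoundedLatticeHom B Bool) _ _ fun b => Bool.eq_iff_iff.2 (h b)

open Classical in
/-- The element of the Stone spectrum given by a prime filter. -/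
noncomputable def ofPred (P : B → Prop) (top : P ⊤) (bot : ¬ P ⊥)
    (inf : ∀ a b, P (a ⊓ b) ↔ P a ∧ P b) (sup : ∀ a b, P (a ⊔ b) ↔ P a ∨ P b) : StoneSpace B :=
  ({ toFun := fun b => decide (P b)
     map_sup' := fun a b => by simp [sup]
     map_inf' := fun a b => by simp [inf]
     map_top' := by simpa using top
     map_bot' := by simpa using bot } : BoundedLatticeHom B Bool)

lemma ofPred_iff {P : B → Prop} (top : P ⊤) (bot : ¬ P ⊥)
    (inf : ∀ a b, P (a ⊓ b) ↔ P a ∧ P b) (sup : ∀ a b, P (a ⊔ b) ↔ P a ∨ P b) (b : B) :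
    (ofPred P top bot inf sup).toHom b = true ↔ P b := by
  classical
  exact decide_eq_true_iff

/-- The prime ideal theorem separates `I` from the principal filter of `b`; the complement of the
resulting prime ideal is a prime filter, hence a two-valued homomorphism. -/
lemma exists_of_notMem_ideal {I : Order.Ideal B} {b : B} (hb : b ∉ I) :
    ∃ φ : StoneSpace B, φ.toHom b = true ∧ ∀ a ∈ I, φ.toHom a ≠ true := by
  have hd : Disjoint (Order.PFilter.principal b : Set B) (I : Set B) := by
    rw [Set.disjoint_left]
    exact fun c hc hI => hb (I.lower (Order.PFilter.mem_principal.1 hc) hI)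
  obtain ⟨Q, hQ, hIQ, hbQ⟩ := DistribLattice.prime_ideal_of_disjoint_filter_ideal hd
  have hbQ' : b ∉ Q := Set.disjoint_left.1 hbQ (Order.PFilter.mem_principal.2 le_rfl)
  have key := ofPred_iff (P := fun c => c ∉ Q)
    (fun h => hbQ' (Q.lower le_top h)) (fun h => h Q.bot_mem)
    (fun c d => by
      rw [← not_or, not_iff_not]
      exact ⟨fun h => hQ.mem_or_mem h,
        fun h => h.elim (fun h => Q.lower inf_le_left h) (fun h => Q.lower inf_le_right h)⟩)
    (fun c d => by rw [← not_and_or, not_iff_not, Order.Ideal.sup_mem_iff])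
  exact ⟨_, (key b).2 hbQ', fun c hc h => (key c).1 h (hIQ hc)⟩

/-- The Stone spectrum is compact, in algebraic form. -/
lemma exists_finset_le_sup {A : Set B} {b : B}
    (h : ∀ φ : StoneSpace B, φ.toHom b = true → ∃ a ∈ A, φ.toHom a = true) :
    ∃ t : Finset B, ↑t ⊆ A ∧ b ≤ t.sup id := by
  classical
  -- The elements below finite joins from `A` form an ideal. Were `b` outside it, some homomorphism
  -- would be true at `b` and false on all of `A`.
  let I : Order.Ideal B :=
    { carrier := {c | ∃ t : Finset B, ↑t ⊆ A ∧ c ≤ t.sup id}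
      lower' := fun c d hdc ⟨t, ht, hc⟩ => ⟨t, ht, hdc.trans hc⟩
      nonempty' := ⟨⊥, ∅, by simp, bot_le⟩
      directed' := by
        rintro c ⟨t, ht, hc⟩ d ⟨s, hs, hd⟩
        refine ⟨c ⊔ d, ⟨t ∪ s, by simp [ht, hs], ?_⟩, le_sup_left, le_sup_right⟩
        rw [Finset.sup_union]
        exact sup_le_sup hc hd }
  by_contra hb
  obtain ⟨φ, hφ, hφI⟩ := exists_of_notMem_ideal (I := I) (b := b) hb
  obtain ⟨a, ha, hφa⟩ := h φ hφ
  exact hφI a ⟨{a}, by simpa using ha, by simp⟩ hφa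

lemma le_of_forall {a b : B} (h : ∀ φ : StoneSpace B, φ.toHom a = true → φ.toHom b = true) :
    a ≤ b := by
  obtain ⟨t, ht, hb⟩ := exists_finset_le_sup (A := {b}) (b := a) (fun φ hφ => ⟨b, rfl, h φ hφ⟩)
  exact hb.trans (Finset.sup_le fun c hc => (ht hc).le)

lemma toHom_mono (φ : StoneSpace B) {a b : B} (h : a ≤ b) (ha : φ.toHom a = true) :
    φ.toHom b = true :=
  top_le_iff.1 (ha.symm.le.trans (OrderHomClass.mono φ.toHom h))

lemma toHom_finset_sup_iff (φ : StoneSpace B) (t : Finset B) :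
    φ.toHom (t.sup id) = true ↔ ∃ a ∈ t, φ.toHom a = true := by
  classical
  induction t using Finset.induction_on with
  | empty => simp
  | insert a t _ ih => 
    rw [Finset.sup_insert, map_sup, Finset.exists_mem_insert, ← ih]
    simp

/-- The basic clopen subset of the Stone spectrum given by an element of the Boolean algebra. -/
def basicOpen (b : B) : Opens (StoneSpace B) :=
  ⟨{φ | φ.toHom b = true}, isOpen_generateFrom_of_mem ⟨b, rfl⟩⟩

lemma mem_basicOpen {b : B} {φ : StoneSpace B} : φ ∈ basicOpen b ↔ φ.toHom b = true := Iff.rfl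

lemma basicOpen_mono : Monotone (basicOpen : B → Opens (StoneSpace B)) :=
  fun _ _ h φ hφ => φ.toHom_mono h hφ

lemma basicOpen_le_iff {a b : B} : basicOpen a ≤ basicOpen b ↔ a ≤ b :=
  ⟨fun h => le_of_forall fun _ hφ => h hφ, fun h => basicOpen_mono h⟩

/-- The generating sets are closed under finite intersection, so they form a basis and not merely a
subbasis. -/
lemma exists_basicOpen_le {U : Set (StoneSpace B)} (hU : IsOpen U) {φ : StoneSpace B}
    (hφ : φ ∈ U) : ∃ b, φ ∈ basicOpen b ∧ (basicOpen b : Set (StoneSpace B)) ⊆ U := by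
  induction hU with
  | basic s hs =>
    obtain ⟨b, rfl⟩ := hs
    exact ⟨b, hφ, subset_rfl⟩
  | univ => exact ⟨⊤, map_top φ.toHom, Set.subset_univ _⟩
  | inter s t _ _ hs ht =>
    obtain ⟨a, ha, has⟩ := hs hφ.1
    obtain ⟨b, hb, hbt⟩ := ht hφ.2
    refine ⟨a ⊓ b, ?_, fun ψ hψ => ⟨has (basicOpen_mono inf_le_left hψ),
      hbt (basicOpen_mono inf_le_right hψ)⟩⟩
    rw [mem_basicOpen] at ha hb ⊢
    rw [map_inf, ha, hb]
    rfl
  | sUnion S _ ih =>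
    obtain ⟨s, hs, hφs⟩ := hφ
    obtain ⟨b, hb, hbs⟩ := ih s hs hφs
    exact ⟨b, hb, hbs.trans (Set.subset_sUnion_of_mem hs)⟩

lemma compl_basicOpen (b : B) :
    (basicOpen b : Set (StoneSpace B))ᶜ = basicOpen bᶜ := by
  ext φ
  change ¬ φ.toHom b = true ↔ φ.toHom bᶜ = true
  rw [map_compl']
  simp

/-- The basic clopen subsets, as a homomorphism of Boolean algebras. -/
def basicClopen (B : Type u) [BooleanAlgebra B] : BoundedLatticeHom B (Clopens (StoneSpace B)) where
  toFun b := ⟨basicOpen b,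
    ⟨⟨by rw [compl_basicOpen]; exact (basicOpen bᶜ).isOpen⟩, (basicOpen b).isOpen⟩⟩
  map_sup' a b := by
    ext φ
    change φ.toHom (a ⊔ b) = true ↔ φ.toHom a = true ∨ φ.toHom b = true
    simp
  map_inf' a b := by
    ext φ
    change φ.toHom (a ⊓ b) = true ↔ φ.toHom a = true ∧ φ.toHom b = true
    simp
  map_top' := by
    ext φ
    exact iff_of_true (map_top φ.toHom) trivial
  map_bot' := by
    ext φ
    exact iff_of_false (fun h => Bool.false_ne_true ((map_bot φ.toHom).symm.trans h)) id

lemma mem_basicClopen {b : B} {φ : StoneSpace B} :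
    φ ∈ basicClopen B b ↔ φ.toHom b = true := Iff.rfl

/-- Injectivity is the separation of elements by homomorphisms. For surjectivity, basic opens lying
inside a clopen `V` or inside its complement cover the spectrum; by compactness finitely many
suffice, and the join of those inside `V` represents `V`. -/
lemma basicClopen_bijective : Function.Bijective (basicClopen B) := by
  classical
  refine ⟨fun a b h => ?_, fun V => ?_⟩
  · have h' : ∀ φ : StoneSpace B, φ.toHom a = true ↔ φ.toHom b = true := fun φ => by
      rw [← mem_basicClopen, ← mem_basicClopen, h]
    exact le_antisymm (le_of_forall fun φ => (h' φ).1) (le_of_forall fun φ => (h' φ).2)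
  · obtain ⟨t, ht, htop⟩ := exists_finset_le_sup (b := (⊤ : B))
      (A := {b | (basicOpen b : Set (StoneSpace B)) ⊆ V ∨
        (basicOpen b : Set (StoneSpace B)) ⊆ (V : Set (StoneSpace B))ᶜ}) (fun φ _ => by
        by_cases hφ : φ ∈ (V : Set (StoneSpace B))
        · obtain ⟨b, hb, hbV⟩ := exists_basicOpen_le V.isClopen.isOpen hφ
          exact ⟨b, Or.inl hbV, hb⟩
        · obtain ⟨b, hb, hbV⟩ := exists_basicOpen_le V.isClopen.compl.isOpen hφ
          exact ⟨b, Or.inr hbV, hb⟩)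
    refine ⟨(t.filter fun b => (basicOpen b : Set (StoneSpace B)) ⊆ V).sup id, ?_⟩
    ext φ
    refine (mem_basicClopen.trans (toHom_finset_sup_iff φ _)).trans ⟨?_, fun hφ => ?_⟩
    · rintro ⟨b, hb, hφb⟩
      exact (Finset.mem_filter.1 hb).2 hφb
    · obtain ⟨b, hb, hφb⟩ := (toHom_finset_sup_iff φ t).1 (φ.toHom_mono htop (map_top _))
      exact ⟨b, Finset.mem_filter.2 ⟨hb, (ht hb).resolve_right fun h => h hφb hφ⟩, hφb⟩

/-- The element of the Stone spectrum of the algebra of clopen subsets given by a point. -/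
noncomputable def ofPoint {X : Type u} [TopologicalSpace X] (x : X) : StoneSpace (Clopens X) :=
  ofPred (fun V => x ∈ V) trivial (fun h => h) (fun _ _ => Iff.rfl) (fun _ _ => Iff.rfl)

lemma ofPoint_iff {X : Type u} [TopologicalSpace X] {x : X} {V : Clopens X} :
    (ofPoint x).toHom V = true ↔ x ∈ V :=
  ofPred_iff (P := fun V : Clopens X => x ∈ V) _ _ _ _ V

end StoneSpace

/-! ### The Stone adjunction -/

/-- The unit of the Stone adjunction. -/
noncomputable def stoneUnit : 𝟭 TopCat.{u} ⟶ clopenAlgebra ⋙ stoneSpectrum where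
  app X := TopCat.ofHom
    { toFun := fun x => StoneSpace.ofPoint x
      continuous_toFun := continuous_generateFrom_iff.2 (by
        rintro _ ⟨V, rfl⟩
        have h : (fun x : X => StoneSpace.ofPoint x) ⁻¹'
            {φ : StoneSpace (Clopens X) | φ.toHom V = true} = (V : Clopens X).carrier :=
          Set.ext fun x => StoneSpace.ofPoint_iff
        exact h ▸ V.isClopen.isOpen) }
  naturality X Y f := by
    ext x
    apply StoneSpace.ext_of_iff (B := Clopens Y)
    intro V
    exact StoneSpace.ofPoint_iff.trans (StoneSpace.ofPoint_iff
      (V := (⟨f ⁻¹' V, V.isClopen.preimage f.hom.continuous⟩ : Clopens X))).symm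

/-- The counit of the Stone adjunction. -/
noncomputable def stoneCounit : stoneSpectrum ⋙ clopenAlgebra ⟶ 𝟭 BoolAlg.{u}ᵒᵖ where
  app B := (BoolAlg.ofHom (StoneSpace.basicClopen B.unop)).op
  naturality _ _ _ := rfl

/-- The Stone adjunction. -/
noncomputable def stoneAdjunction : clopenAlgebra.{u} ⊣ stoneSpectrum :=
  Adjunction.mkOfUnitCounit
    { unit := stoneUnit
      counit := stoneCounit
      left_triangle := by
        ext X
        apply Quiver.Hom.unop_inj
        ext V
        apply Clopens.ext
        ext x
        exact StoneSpace.ofPoint_iff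
      right_triangle := by
        ext B φ
        apply StoneSpace.ext_of_iff (B := B.unop)
        intro b
        exact StoneSpace.ofPoint_iff (V := StoneSpace.basicClopen B.unop b) }

lemma stoneAdjunction_homEquiv_iff (X : TopCat.{u}) (B : BoolAlg.{u}ᵒᵖ)
    (h : clopenAlgebra.obj X ⟶ B) (x : X) (b : B.unop) :
    StoneSpace.toHom (B := B.unop) (stoneAdjunction.homEquiv X B h x) b = true ↔
      x ∈ TopologicalSpace.Clopens.carrier (α := X) (h.unop b) := by
  rw [Adjunction.homEquiv_unit]
  exact StoneSpace.ofPoint_iff (V := (h.unop b : Clopens X))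

/-- The counit at `B` is `basicClopen`, a bijection that preserves and reflects the order; an order
isomorphism respects all the Boolean operations. -/
instance : IsIso stoneAdjunction.{u}.counit := by
  have (B : BoolAlg.{u}ᵒᵖ) : IsIso (stoneAdjunction.counit.app B) := by
    have h : IsIso (BoolAlg.ofHom (StoneSpace.basicClopen B.unop)) := by
      let e : B.unop ≃o Clopens (StoneSpace B.unop) :=
        { toEquiv := Equiv.ofBijective _ StoneSpace.basicClopen_bijective
          map_rel_iff' := StoneSpace.basicOpen_le_iff }
      exact inferInstanceAs (IsIso (BoolAlg.Iso.mk (β := BoolAlg.of _) e).hom)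
    exact inferInstanceAs (IsIso (BoolAlg.ofHom (StoneSpace.basicClopen B.unop)).op)
  exact NatIso.isIso_of_isIso_app _

/-! ### Isomorphisms of toposes paired with points -/

section Isomorphisms

variable {E F : Type (u + 1)} [Category.{u} E] [Category.{u} F]

/-- The geometric morphism whose direct image is a given equivalence. -/
def GeomMorph.ofEquivalence (e : E ≌ F) : GeomMorph E F where
  inv := e.inverse
  dir := e.functor
  adj := e.symm.toAdjunction
  lex := inferInstance

lemma GeomClass.ofEquivalence_comp_symm (e : E ≌ F) :
    (mk (GeomMorph.ofEquivalence e)).comp (mk (GeomMorph.ofEquivalence e.symm)) =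
      mk (GeomMorph.id E) :=
  mk_eq_of_dir e.unitIso.symm

lemma PointedTopos.isIso_of_isEquivalence {P Q : PointedTopos.{u}} (f : P ⟶ Q)
    (q : GeomMorph P.topos Q.topos) (hq : f.geom = GeomClass.mk q)
    (hq' : q.dir.IsEquivalence) (hf : Function.Bijective f.index) : IsIso f := by
  let e := q.dir.asEquivalence
  -- The direct image determines the class of a geometric morphism, so the adjoint of `q` may be
  -- replaced by the inverse of the equivalence.
  have he : f.geom = GeomClass.mk (GeomMorph.ofEquivalence e) :=
    hq.trans (GeomClass.mk_eq_of_dir (Iso.refl _))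
  have h₁ : f.geom.comp (GeomClass.mk (GeomMorph.ofEquivalence e.symm)) =
      GeomClass.mk (GeomMorph.id _) := by
    rw [he]
    exact GeomClass.ofEquivalence_comp_symm e
  have h₂ : (GeomClass.mk (GeomMorph.ofEquivalence e.symm)).comp f.geom =
      GeomClass.mk (GeomMorph.id _) := by
    rw [he]
    exact GeomClass.ofEquivalence_comp_symm e.symm
  let i := Equiv.ofBijective _ hf
  let g : Q ⟶ P :=
    { geom := GeomClass.mk (GeomMorph.ofEquivalence e.symm)
      index := i.symm
      comm := fun y => by
        obtain ⟨x, rfl⟩ := i.surjective y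
        rw [i.symm_apply_apply]
        change (Q.pt (f.index x)).comp _ = _
        rw [← f.comm, GeomClass.assoc, h₁, GeomClass.comp_id] }
  exact ⟨g, PointedTopos.Hom.ext h₁ (funext i.symm_apply_apply),
    PointedTopos.Hom.ext h₂ (funext i.apply_symm_apply)⟩

/-- Distinct indices of `allPoints` name distinct points, so the compatibility condition forces the
index function. -/
lemma PointedTopos.allPoints_hom_ext {P : PointedTopos.{u}} [Small.{u} (PointClass E)]
    {h : IsGrothendieckTopos E} {f g : P ⟶ PointedTopos.allPoints E h}
    (hfg : f.geom = g.geom) : f = g := by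
  refine PointedTopos.Hom.ext hfg (funext fun x => ?_)
  apply (equivShrink (PointClass E)).symm.injective
  exact (f.comm x).symm.trans ((congrArg _ hfg).trans (g.comm x))

end Isomorphisms

/-! ### Points of the topos of a Boolean algebra -/

section Points

variable {B : Type u} [BooleanAlgebra B]

lemma PointClass.holds_mk (q : GeomMorph (Type u) (Sheaf (coherentTop B) (Type u))) (b : B) :
    PointClass.Holds (GeomClass.mk q) b ↔ Nonempty ((presheafInv q).obj (yoneda.obj b)) :=
  Iff.rfl

/-- A set is nonempty exactly when it has no map to the empty set, and by adjunction such maps are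
sections over `b` of the direct image of the empty set. This makes `Holds` accessible through direct
images, which are explicit. -/
lemma PointClass.holds_mk_iff_isEmpty (q : GeomMorph (Type u) (Sheaf (coherentTop B) (Type u)))
    (b : B) : PointClass.Holds (GeomClass.mk q) b ↔
      IsEmpty ((q.dir.obj PEmpty.{u + 1}).obj.obj (op b)) := by
  have e : ((presheafInv q).obj (yoneda.obj b) ⟶ PEmpty.{u + 1}) ≃
      (q.dir.obj PEmpty.{u + 1}).obj.obj (op b) :=
    (((sheafificationAdjunction _ _).comp q.adj).homEquiv _ _).trans yonedaEquiv
  rw [PointClass.holds_mk, ← not_nonempty_iff, ← e.nonempty_congr]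
  refine ⟨fun ⟨x⟩ ⟨f⟩ => (f x).elim, fun h => ?_⟩
  by_contra hx
  rw [not_nonempty_iff] at hx
  exact h ⟨↾fun x => hx.elim x⟩

end Points

/-! ### The Stone spectrum as a dense extension of the algebra -/

/-- The morphism of sites from a Boolean algebra to the opens of its Stone spectrum. -/
def stoneOpens (B : BoolAlg.{u}ᵒᵖ) : B.unop ⥤ Opens (stoneSpectrum.obj B) :=
  (StoneSpace.basicOpen_mono (B := B.unop)).functor

instance (B : BoolAlg.{u}ᵒᵖ) : RepresentablyFlat (stoneOpens B) where
  cofiltered U :=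
    { nonempty := ⟨StructuredArrow.mk (Y := (⊤ : B.unop))
        (homOfLE fun φ _ => map_top (StoneSpace.toHom (B := B.unop) φ))⟩
      cone_objs := fun X Y =>
        ⟨StructuredArrow.mk (Y := (X.right ⊓ Y.right : B.unop))
            (homOfLE fun φ hφ => by
              refine (map_inf (StoneSpace.toHom (B := B.unop) φ) _ _).trans ?_
              exact (congrArg₂ (· ⊓ ·) (X.hom.le hφ) (Y.hom.le hφ)).trans rfl),
          StructuredArrow.homMk (homOfLE inf_le_left) (Subsingleton.elim _ _),
          StructuredArrow.homMk (homOfLE inf_le_right) (Subsingleton.elim _ _), trivial⟩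
      cone_maps := fun X Y f g =>
        ⟨X, 𝟙 X, by congr 1; ext; exact Subsingleton.elim _ _⟩ }

instance (B : BoolAlg.{u}ᵒᵖ) : (stoneOpens B).Full where
  map_surjective f := ⟨homOfLE (StoneSpace.basicOpen_le_iff.1 f.le), Subsingleton.elim _ _⟩

instance (B : BoolAlg.{u}ᵒᵖ) : (stoneOpens B).Faithful where
  map_injective _ := Subsingleton.elim _ _

instance (B : BoolAlg.{u}ᵒᵖ) :
    (stoneOpens B).IsCoverDense (Opens.grothendieckTopology (stoneSpectrum.obj B)) where
  is_cover U φ hφ := by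
    obtain ⟨b, hb, hbU⟩ := StoneSpace.exists_basicOpen_le U.isOpen hφ
    exact ⟨(stoneOpens B).obj b, homOfLE hbU, ⟨⟨b, 𝟙 _, homOfLE hbU, Subsingleton.elim _ _⟩⟩, hb⟩

/-- From a topological cover, compactness extracts a finite join above `b`, which equals `b` because
its members lie below `b`. Conversely, a homomorphism true at a finite join is true at one of its
members. -/
instance (B : BoolAlg.{u}ᵒᵖ) : (stoneOpens B).IsDenseSubsite (coherentTop B.unop)
    (Opens.grothendieckTopology (stoneSpectrum.obj B)) where
  functorPushforward_mem_iff {b S} := by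
    classical
    constructor
    · intro h
      obtain ⟨t, ht, hb⟩ := StoneSpace.exists_finset_le_sup (B := B.unop)
        (A := {a | ∃ f : a ⟶ b, S f}) (b := b) (fun φ hφ => by
          obtain ⟨U, f, ⟨a, g, i, hg, -⟩, hU⟩ := h φ hφ
          exact ⟨a, ⟨g, hg⟩, i.le hU⟩)
      exact ⟨t, fun a ha => ht ha, le_antisymm (Finset.sup_le fun a ha => (ht ha).choose.le) hb⟩
    · rintro ⟨t, ht, hb⟩ φ hφ
      have hφ' : StoneSpace.toHom (B := B.unop) φ (t.sup id) = true :=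
        (congrArg (StoneSpace.toHom (B := B.unop) φ) hb).trans hφ
      obtain ⟨a, ha, hφa⟩ := (StoneSpace.toHom_finset_sup_iff (B := B.unop) φ t).1 hφ'
      obtain ⟨f, hf⟩ := ht a ha
      exact ⟨_, (stoneOpens B).map f, ⟨a, f, 𝟙 _, hf, Subsingleton.elim _ _⟩, hφa⟩

/-- The equivalence of toposes between sheaves on the Stone spectrum of a Boolean algebra and
sheaves on the algebra. -/
noncomputable def stoneGeom (B : BoolAlg.{u}ᵒᵖ) :
    GeomMorph (Sheaf (Opens.grothendieckTopology (stoneSpectrum.obj B)) (Type u))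
      (Sheaf (coherentTop B.unop) (Type u)) :=
  GeomMorph.ofSite (stoneOpens B) _ _

instance (B : BoolAlg.{u}ᵒᵖ) : (stoneGeom B).dir.IsEquivalence :=
  inferInstanceAs ((stoneOpens B).sheafPushforwardContinuous (Type u) (coherentTop B.unop)
    (Opens.grothendieckTopology (stoneSpectrum.obj B))).IsEquivalence

/-! ### The prime filter of a point -/

section PrimeFilter

variable {B : Type u} [BooleanAlgebra B]

lemma PointClass.Holds.mono {p : PointClass (Sheaf (coherentTop B) (Type u))} {a b : B}
    (hab : a ≤ b) (h : p.Holds a) : p.Holds b := by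
  induction p using Quotient.inductionOn with | _ q
  exact h.map ((presheafInv q).map (yoneda.map (homOfLE hab)))

lemma PointClass.holds_top (p : PointClass (Sheaf (coherentTop B) (Type u))) : p.Holds ⊤ := by
  induction p using Quotient.inductionOn with | _ q
  have := q.lex
  have : PreservesFiniteLimits (presheafInv q) := comp_preservesFiniteLimits _ _
  have ht : IsTerminal (⊤ : B) := isTerminalTop
  have h := (ht.isTerminalObj yoneda).isTerminalObj (presheafInv q)
  exact ⟨((Types.isTerminalEquivUnique _) h).default⟩

/-- The meet is a product in `B`, and the Yoneda embedding, sheafification and the inverse image all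
preserve it; two elements therefore pair to one. -/
lemma PointClass.Holds.inf {p : PointClass (Sheaf (coherentTop B) (Type u))} {a b : B}
    (ha : p.Holds a) (hb : p.Holds b) : p.Holds (a ⊓ b) := by
  induction p using Quotient.inductionOn with | _ q
  have := q.lex
  have : PreservesFiniteLimits (presheafInv q) := comp_preservesFiniteLimits _ _
  have : PreservesFiniteLimits (yoneda ⋙ presheafInv q) := comp_preservesFiniteLimits _ _
  obtain ⟨x⟩ := ha
  obtain ⟨y⟩ := hb
  let c : BinaryFan a b := BinaryFan.mk (homOfLE inf_le_left) (homOfLE inf_le_right)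
  have hc : IsLimit c := BinaryFan.IsLimit.mk c (fun f g => homOfLE (le_inf f.le g.le))
    (fun _ _ => Subsingleton.elim _ _) (fun _ _ => Subsingleton.elim _ _)
    (fun _ _ _ _ _ => Subsingleton.elim _ _)
  have hl := mapIsLimitOfPreservesOfIsLimit (yoneda ⋙ presheafInv q) _ _ hc
  exact ⟨(BinaryFan.IsLimit.lift' (W := PUnit.{u + 1}) hl (↾fun _ => x) (↾fun _ => y)).1 ⟨⟩⟩

/-- Let `P` be the direct image of the empty set. If no member of `t` holds, `P` has a section over
each of them. Sections of `P` are unique, so these are compatible and glue over the join, which then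
cannot hold. For empty `t` this says that `⊥` never holds. -/
lemma PointClass.holds_finset_sup_iff (p : PointClass (Sheaf (coherentTop B) (Type u)))
    (t : Finset B) : p.Holds (t.sup id) ↔ ∃ a ∈ t, p.Holds a := by
  refine ⟨fun h => ?_, fun ⟨a, ha, h⟩ => h.mono (Finset.le_sup (f := id) ha)⟩
  induction p using Quotient.inductionOn with | _ q
  by_contra! hn
  change Holds (GeomClass.mk q) _ at h
  rw [holds_mk_iff_isEmpty] at h
  let P := q.dir.obj PEmpty.{u + 1}
  have hs (c : B) : Subsingleton (P.obj.obj (op c)) :=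
    (((sheafificationAdjunction _ _).comp q.adj).homEquiv (yoneda.obj c) PEmpty.{u + 1}
      |>.trans yonedaEquiv).symm.subsingleton_congr.2 ⟨fun f g => by ext x; exact (f x).elim⟩
  let S : Sieve (t.sup id) :=
    { arrows := fun c _ => ∃ a ∈ t, c ≤ a
      downward_closed := fun ⟨a, ha, h⟩ g => ⟨a, ha, g.le.trans h⟩ }
  have hS : S ∈ coherentTop B (t.sup id) :=
    ⟨t, fun a ha => ⟨homOfLE (Finset.le_sup (f := id) ha), a, ha, le_rfl⟩, rfl⟩
  have hne (c : B) (hc : ∃ a ∈ t, c ≤ a) : Nonempty (P.obj.obj (op c)) := by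
    obtain ⟨a, ha, hca⟩ := hc
    by_contra he
    rw [not_nonempty_iff] at he
    exact hn a ha (Holds.mono (p := GeomClass.mk q) hca ((holds_mk_iff_isEmpty q c).2 he))
  have hP : Presieve.IsSheaf (coherentTop B) P.obj := (isSheaf_iff_isSheaf_of_type _ _).1 P.property
  obtain ⟨x, -, -⟩ := hP S hS (fun c _ hc => (hne c hc).some) (fun _ _ _ _ _ _ _ _ _ _ =>
    (hs _).elim _ _)
  exact h.elim x

end PrimeFilter

open Classical in
/-- The prime filter of the elements of a Boolean algebra that hold at a point. -/
noncomputable def StoneSpace.ofPointClass {B : Type u} [BooleanAlgebra B]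
    (p : PointClass (Sheaf (coherentTop B) (Type u))) : StoneSpace B :=
  ofPred p.Holds p.holds_top
    (fun h => by simpa using (p.holds_finset_sup_iff ∅).1 (by simpa using h))
    (fun _ _ => ⟨fun h => ⟨h.mono inf_le_left, h.mono inf_le_right⟩, fun h => h.1.inf h.2⟩)
    (fun a b => by simpa using p.holds_finset_sup_iff {a, b})

lemma StoneSpace.ofPointClass_iff {B : Type u} [BooleanAlgebra B]
    {p : PointClass (Sheaf (coherentTop B) (Type u))} {b : B} :
    (ofPointClass p).toHom b = true ↔ p.Holds b := ofPred_iff _ _ _ _ b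

/-- The direct image of a point is a skyscraper sheaf, whose sections over `b` are a product indexed
by the proofs that `φ` lies in the basic open of `b`. A product of empty sets is empty exactly when
its index type is inhabited. -/
lemma holds_stoneGeom_iff (B : BoolAlg.{u}ᵒᵖ) (φ : stoneSpectrum.obj B) (b : B.unop) :
    PointClass.Holds (((spaceFunctor.obj (stoneSpectrum.obj B)).pt φ).comp
      (GeomClass.mk (stoneGeom B))) b ↔ StoneSpace.toHom (B := B.unop) φ b = true := by
  refine (PointClass.holds_mk_iff_isEmpty
    ((GeomMorph.ofPoint (Opens.pointGrothendieckTopology φ)).comp (stoneGeom B)) b).trans ?_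
  change IsEmpty (∏ᶜ fun _ : ULift.{u} (PLift (φ ∈ (stoneOpens B).obj b)) => PEmpty.{u + 1}) ↔ _
  refine ⟨fun h => ?_, fun h => ⟨fun x => ?_⟩⟩
  · by_contra hφ
    exact h.elim ((Pi.lift (P := PUnit.{u + 1})
      fun x : ULift.{u} (PLift (φ ∈ (stoneOpens B).obj b)) => (hφ x.down.down).elim) ⟨⟩)
  · exact (Pi.π (fun _ : ULift.{u} (PLift (φ ∈ (stoneOpens B).obj b)) => PEmpty.{u + 1})
      ⟨⟨h⟩⟩ x).elim

/-! ### The natural isomorphism for Boolean algebras -/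

/-- The isomorphism of toposes paired with points from the Stone spectrum of a Boolean algebra to
the algebra. -/
noncomputable def stoneHom (B : BoolAlg.{u}ᵒᵖ) :
    spaceFunctor.obj (stoneSpectrum.obj B) ⟶ boolAlgFunctor.obj B :=
  PointedTopos.Hom.mk (Q := boolAlgFunctor.obj B)
    (GeomClass.mk (stoneGeom B))
    (fun φ => equivShrink (PointClass (Sheaf (coherentTop B.unop) (Type u)))
      (((spaceFunctor.obj (stoneSpectrum.obj B)).pt φ).comp (GeomClass.mk (stoneGeom B))))
    (fun _ => (Equiv.symm_apply_apply _ _).symm)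

lemma stoneHom_index_iff (B : BoolAlg.{u}ᵒᵖ) (φ : stoneSpectrum.obj B) (b : B.unop) :
    PointClass.Holds ((boolAlgFunctor.obj B).pt ((stoneHom B).index φ)) b ↔
      StoneSpace.toHom (B := B.unop) φ b = true := by
  exact (iff_of_eq (congrArg (PointClass.Holds · b) ((stoneHom B).comm φ))).symm.trans
    (holds_stoneGeom_iff B φ b)

/-- The geometric part is an equivalence. On indices, `φ` is recovered from the elements holding at
its image, and every point comes from its prime filter because `Holds` determines a point. -/
instance (B : BoolAlg.{u}ᵒᵖ) : IsIso (stoneHom B) := by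
  refine PointedTopos.isIso_of_isEquivalence (stoneHom B) (stoneGeom B) rfl
    (hq' := inferInstanceAs (stoneGeom B).dir.IsEquivalence) ⟨?_, ?_⟩
  · intro φ ψ h
    apply StoneSpace.ext_of_iff (B := B.unop)
    intro b
    exact (stoneHom_index_iff B φ b).symm.trans
      ((iff_of_eq (congrArg (fun i => ((boolAlgFunctor.obj B).pt i).Holds b) h)).trans
        (stoneHom_index_iff B ψ b))
  · intro p
    refine ⟨StoneSpace.ofPointClass (B := B.unop) ((boolAlgFunctor.obj B).pt p), ?_⟩
    apply (equivShrink (PointClass (Sheaf (coherentTop B.unop) (Type u)))).symm.injective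
    apply PointClass.holds_injective
    funext b
    exact propext ((stoneHom_index_iff B _ b).trans StoneSpace.ofPointClass_iff)

/-- Only geometric parts need comparing. Both direct images restrict a sheaf along the same functor,
since the preimage of the basic open of `a` is the basic open of its image under the homomorphism.
-/
lemma stoneHom_naturality {A B : BoolAlg.{u}ᵒᵖ} (f : A ⟶ B) :
    spaceFunctor.map (stoneSpectrum.map f) ≫ stoneHom B = stoneHom A ≫ boolAlgFunctor.map f := by
  have := homFunctor_flat f.unop.hom
  have := homFunctor_continuous f.unop.hom
  refine PointedTopos.allPoints_hom_ext (GeomClass.mk_eq_of_dir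
    (f := (GeomMorph.ofSite (Opens.map (stoneSpectrum.map f)) _ _).comp (stoneGeom B))
    (g := (stoneGeom A).comp (GeomMorph.ofSite
      (OrderHomClass.mono f.unop.hom : Monotone f.unop.hom).functor _ _)) (Iso.refl _))

/-- The topos paired with points of a Boolean algebra is that of its Stone spectrum. -/
noncomputable def stoneIso : boolAlgFunctor.{u} ≅ stoneSpectrum ⋙ spaceFunctor :=
  (NatIso.ofComponents (F := stoneSpectrum ⋙ spaceFunctor) (fun B => asIso (stoneHom B))
    stoneHom_naturality).symm

lemma stoneIso_index_iff (B : BoolAlg.{u}ᵒᵖ) (p : (boolAlgFunctor.obj B).Index) (b : B.unop) :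
    StoneSpace.toHom (B := B.unop) ((stoneIso.hom.app B).index p) b = true ↔
      PointClass.Holds ((boolAlgFunctor.obj B).pt p) b := by
  have h : (stoneHom B).index ((stoneIso.hom.app B).index p) = p :=
    congrFun (congrArg PointedTopos.Hom.index (stoneIso.hom_inv_id_app B)) p
  exact (stoneHom_index_iff B _ b).symm.trans
    (iff_of_eq (congrArg (fun i => ((boolAlgFunctor.obj B).pt i).Holds b) h))

lemma exists_stone_data :
    ∃ (Φ : FunctionalData boolAlgFunctor.{u} spaceFunctor.{u} stoneSpectrum.obj
          clopenAlgebra.obj)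
        (a : clopenAlgebra.{u} ⊣ stoneSpectrum.{u}),
      (∀ (B : BoolAlg.{u}ᵒᵖ) (p : (boolAlgFunctor.obj B).Index) (b : B.unop),
        StoneSpace.toHom (B := B.unop) ((Φ.ξ B).index p) b = true ↔
          PointClass.Holds ((boolAlgFunctor.obj B).pt p) b) ∧
      (∀ (X : TopCat.{u}) (x : X) (V : TopologicalSpace.Clopens X),
        PointClass.Holds ((boolAlgFunctor.obj (clopenAlgebra.obj X)).pt ((Φ.χ X).index x)) V ↔
          x ∈ V) ∧
      (∀ (X : TopCat.{u}) (B : BoolAlg.{u}ᵒᵖ) (h : clopenAlgebra.obj X ⟶ B) (x : X)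
          (b : B.unop),
        StoneSpace.toHom (B := B.unop) (a.homEquiv X B h x) b = true ↔
          x ∈ TopologicalSpace.Clopens.carrier (α := X) (h.unop b)) ∧
      IsIso a.counit ∧
      Φ.Yields a := by
  refine ⟨FunctionalData.ofAdjunction stoneAdjunction stoneIso, stoneAdjunction,
    stoneIso_index_iff, fun X x V => ?_, stoneAdjunction_homEquiv_iff, inferInstance,
    FunctionalData.yields _ _ (fun _ => rfl) (fun _ => rfl)
      (fun k => stoneIso.hom.naturality k)⟩
  -- The equation `χ ≫ ξ = J(η)` on indices: `ξ` sends the point `χ(x)` to the ultrafilter of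
  -- clopens containing `x`.
  have h : (stoneIso.hom.app (clopenAlgebra.obj X)).index
      (((FunctionalData.ofAdjunction stoneAdjunction stoneIso).χ X).index x) =
        stoneAdjunction.unit.app X x :=
    congrFun (congrArg PointedTopos.Hom.index
      ((FunctionalData.ofAdjunction stoneAdjunction stoneIso).χ_ξ X)) x
  exact (stoneIso_index_iff (clopenAlgebra.obj X) _ V).symm.trans ((iff_of_eq (congrArg (fun φ =>
    StoneSpace.toHom (B := Clopens X) φ V = true) h)).trans StoneSpace.ofPoint_iff)

/-! ### Smallest neighbourhoods in Alexandrov spaces -/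

section Alexandrov

/-- The smallest open neighbourhood of a point of an Alexandrov space. -/
def upperOpen (P : Preord.{u}) (p : P) : Opens (alexandrov.obj P) :=
  ⟨{x | p ≤ Topology.WithUpperSet.ofUpperSet x}, fun _ _ hab ha => le_trans ha hab⟩

lemma mem_upperOpen_self (P : Preord.{u}) (p : P) :
    Topology.WithUpperSet.toUpperSet p ∈ upperOpen P p := le_refl p

lemma upperOpen_le_iff {P : Preord.{u}} {p : P} {U : Opens (alexandrov.obj P)} :
    upperOpen P p ≤ U ↔ Topology.WithUpperSet.toUpperSet p ∈ U :=
  ⟨fun h => h (le_refl p), fun h _ hx => U.isOpen hx h⟩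

/-- The functor sending an element of a preorder to its smallest open neighbourhood. -/
def upperOpens (P : Preord.{u}) : (P : Type u)ᵒᵖ ⥤ Opens (alexandrov.obj P) where
  obj p := upperOpen P p.unop
  map f := homOfLE (upperOpen_le_iff.2 f.unop.le)

instance (P : Preord.{u}) : (upperOpens P).Full where
  map_surjective f := ⟨(homOfLE (upperOpen_le_iff.1 f.le)).op, Subsingleton.elim _ _⟩

instance (P : Preord.{u}) : (upperOpens P).Faithful where
  map_injective _ := Quiver.Hom.unop_inj (Subsingleton.elim _ _)

instance (P : Preord.{u}) :
    (upperOpens P).IsCoverDense (Opens.grothendieckTopology (alexandrov.obj P)) where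
  is_cover U p hp := by
    have h : upperOpen P p ≤ U := upperOpen_le_iff.2 hp
    exact ⟨_, homOfLE h, ⟨⟨op p, 𝟙 _, homOfLE h, Subsingleton.elim _ _⟩⟩,
      mem_upperOpen_self P p⟩

/-- A cover of the smallest neighbourhood of `p` has a member containing `p`, hence containing the
whole neighbourhood. So only the maximal sieve covers, which is the trivial topology. -/
instance (P : Preord.{u}) : (upperOpens P).IsDenseSubsite ⊥
    (Opens.grothendieckTopology (alexandrov.obj P)) where
  functorPushforward_mem_iff {p S} := by
    rw [GrothendieckTopology.bot_covering]
    constructor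
    · intro h
      obtain ⟨U, f, ⟨q, g, i, hg, -⟩, hU⟩ := h (p.unop : P) (le_refl (p.unop : P))
      have hqp : q.unop ≤ p.unop := i.le hU
      rw [← Sieve.id_mem_iff_eq_top]
      have := S.downward_closed hg (homOfLE hqp).op
      rwa [Quiver.Hom.unop_inj (Subsingleton.elim _ _ : ((homOfLE hqp).op ≫ g).unop = (𝟙 p).unop)]
        at this
    · rintro rfl
      rw [Sieve.functorPushforward_top]
      exact GrothendieckTopology.top_mem _ _

/-- Sheaves on the Alexandrov space of a preorder are functors on the preorder. -/
noncomputable def alexandrovEquivalence (P : Preord.{u}) :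
    Sheaf (Opens.grothendieckTopology (alexandrov.obj P)) (Type u) ≌ (P ⥤ Type u) :=
  ((upperOpens P).sheafPushforwardContinuous (Type u) ⊥ (Opens.grothendieckTopology
    (alexandrov.obj P))).asEquivalence.trans
      ((sheafBotEquivalence (Type u)).trans (opOpEquivalence P).congrLeft)

variable {P Q : Preord.{u}}

lemma section_ext (F : Sheaf (Opens.grothendieckTopology (alexandrov.obj P)) (Type u))
    {U : Opens (alexandrov.obj P)} {s t : F.obj.obj (op U)}
    (h : ∀ (p : P) (hp : upperOpen P p ≤ U),
      F.obj.map (homOfLE hp).op s = F.obj.map (homOfLE hp).op t) : s = t :=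
  TopCat.Sheaf.eq_of_locally_eq' (X := alexandrov.obj P) F
    (fun p : {p : P // upperOpen P p ≤ U} => upperOpen P p.1) U (fun p => homOfLE p.2)
    (fun p hp => Opens.mem_iSup.2 ⟨⟨p, upperOpen_le_iff.2 hp⟩, mem_upperOpen_self P p⟩) s t
    (fun p => h p.1 p.2)

/-- Compatibility on an intersection can be tested on the smallest neighbourhoods inside it, where
it follows from `hs`. -/
lemma exists_section (F : Sheaf (Opens.grothendieckTopology (alexandrov.obj P)) (Type u))
    (U : Opens (alexandrov.obj P))
    (s : ∀ p : P, upperOpen P p ≤ U → F.obj.obj (op (upperOpen P p)))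
    (hs : ∀ (p r : P) (hp : upperOpen P p ≤ U) (hr : upperOpen P r ≤ U)
      (hpr : upperOpen P r ≤ upperOpen P p), F.obj.map (homOfLE hpr).op (s p hp) = s r hr) :
    ∃ t : F.obj.obj (op U), ∀ (p : P) (hp : upperOpen P p ≤ U),
      F.obj.map (homOfLE hp).op t = s p hp := by
  obtain ⟨t, ht, -⟩ := TopCat.Sheaf.existsUnique_gluing' (X := alexandrov.obj P) F
    (fun p : {p : P // upperOpen P p ≤ U} => upperOpen P p.1) U (fun p => homOfLE p.2)
    (fun p hp => Opens.mem_iSup.2 ⟨⟨p, upperOpen_le_iff.2 hp⟩, mem_upperOpen_self P p⟩)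
    (fun p => s p.1 p.2) (fun p p' => by
      refine section_ext F fun r hr => ?_
      refine (Functor.map_comp_apply F.obj _ _ _).symm.trans
        (Eq.trans ?_ (Functor.map_comp_apply F.obj _ _ _))
      have h₁ := hs p.1 r p.2 (hr.trans (inf_le_left.trans p.2)) (hr.trans inf_le_left)
      have h₂ := hs p'.1 r p'.2 (hr.trans (inf_le_left.trans p.2)) (hr.trans inf_le_right)
      exact h₁.trans h₂.symm)
  exact ⟨t, fun p hp => ht ⟨p, hp⟩⟩

/-! ### Direct images along monotone maps -/

/-- The direct image of sheaves under the map of Alexandrov spaces given by a monotone map, as a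
functor to functors on the codomain. -/
noncomputable abbrev alexandrovPushforward (f : P ⟶ Q) :
    Sheaf (Opens.grothendieckTopology (alexandrov.obj P)) (Type u) ⥤ (Q ⥤ Type u) :=
  (Opens.map (alexandrov.map f)).sheafPushforwardContinuous (Type u) _ _ ⋙
    (alexandrovEquivalence Q).functor

lemma upperOpen_le_map (f : P ⟶ Q) (p : P) :
    upperOpen P p ≤ (Opens.map (alexandrov.map f)).obj (upperOpen Q (f p)) :=
  upperOpen_le_iff.2 (le_refl (f p))

/-- Restriction of sections to the smallest open neighbourhoods of points. -/
noncomputable def alexandrovRestriction (f : P ⟶ Q) :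
    alexandrovPushforward f ⋙ (Functor.whiskeringLeft P Q (Type u)).obj f.hom.monotone.functor ⟶
      (alexandrovEquivalence P).functor where
  app F :=
    { app p := F.obj.map (homOfLE (upperOpen_le_map f p)).op
      naturality p q g := by
        refine (F.obj.map_comp _ _).symm.trans (Eq.trans ?_ (F.obj.map_comp _ _))
        exact congrArg F.obj.map (Subsingleton.elim _ _) }
  naturality F G g := by
    ext p : 2
    exact (g.hom.naturality _).symm

/-- Naturality of `φ` along `q ≤ f p` recovers the germs of its values from the restricted
transformation; injectivity of the restriction rests on this. -/
lemma map_app_eq_alexandrovRestriction {f : P ⟶ Q} {E : Q ⥤ Type u}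
    {F : Sheaf (Opens.grothendieckTopology (alexandrov.obj P)) (Type u)}
    (φ : E ⟶ (alexandrovPushforward f).obj F) {q : Q} (e : E.obj q) {p : P}
    (hp : upperOpen P p ≤ (Opens.map (alexandrov.map f)).obj (upperOpen Q q)) (hq : q ≤ f p) :
    F.obj.map (homOfLE hp).op (φ.app q e) =
      (Functor.whiskerLeft f.hom.monotone.functor φ ≫ (alexandrovRestriction f).app F).app p
        (E.map (homOfLE hq) e) := by
  change _ = F.obj.map (homOfLE (upperOpen_le_map f p)).op (φ.app (f p) (E.map (homOfLE hq) e))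
  rw [NatTrans.naturality_apply φ]
  exact Functor.map_comp_apply F.obj ((Opens.map (alexandrov.map f)).map
    (homOfLE ((upperOpen_le_iff (U := upperOpen Q q)).2 hq))).op _ _

lemma alexandrovRestriction_bijective (f : P ⟶ Q) (E : Q ⥤ Type u)
    (F : Sheaf (Opens.grothendieckTopology (alexandrov.obj P)) (Type u)) :
    Function.Bijective (fun φ : E ⟶ (alexandrovPushforward f).obj F =>
      Functor.whiskerLeft f.hom.monotone.functor φ ≫ (alexandrovRestriction f).app F) := by
  constructor
  · intro φ ψ h
    dsimp only at h
    ext q e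
    refine section_ext F fun p hp => ?_
    have hq : q ≤ f p := upperOpen_le_iff.1 hp
    exact (map_app_eq_alexandrovRestriction φ e hp hq).trans
      ((congrArg (fun k : f.hom.monotone.functor ⋙ E ⟶
          (alexandrovEquivalence P).functor.obj F => k.app p (E.map (homOfLE hq) e)) h).trans
        (map_app_eq_alexandrovRestriction ψ e hp hq).symm)
  · intro θ
    -- The value at `e` is glued from those of `θ` at the transports of `e` to `f p`, for all `p`
    -- with `q ≤ f p`; naturality of `θ` makes them compatible.
    have key (q : Q) (e : E.obj q) :=
      exists_section F ((Opens.map (alexandrov.map f)).obj (upperOpen Q q))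
        (fun p hp => θ.app p (E.map (homOfLE (upperOpen_le_iff.1 hp : q ≤ f p)) e))
        (fun p r hp hr hpr => by
          have h := NatTrans.naturality_apply θ (homOfLE (upperOpen_le_iff.1 hpr : p ≤ r))
            (E.map (homOfLE (upperOpen_le_iff.1 hp : q ≤ f p)) e)
          exact h.symm.trans (congrArg (θ.app r) (Functor.map_comp_apply E _ _ _).symm))
    choose t ht using key
    refine ⟨{ app := fun q => ↾(t q), naturality := fun q q' g => ?_ }, ?_⟩
    · ext e
      refine section_ext F fun p hp => ?_
      have hqp : q' ≤ f p := upperOpen_le_iff.1 hp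
      have hp' : upperOpen P p ≤ (Opens.map (alexandrov.map f)).obj (upperOpen Q q) :=
        upperOpen_le_iff.2 (g.le.trans hqp)
      refine (ht q' (E.map g e) p hp).trans ((congrArg (θ.app p)
        (Functor.map_comp_apply E _ _ _).symm).trans ((ht q e p hp').symm.trans ?_))
      exact Functor.map_comp_apply F.obj ((Opens.map (alexandrov.map f)).map
        (homOfLE ((upperOpen_le_iff (U := upperOpen Q q)).2 g.le))).op _ _
    · ext p e
      refine (ht (f p) e p (upperOpen_le_map f p)).trans (congrArg (θ.app p) ?_)
      exact congrArg (fun k => k e) (E.map_id (f p))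

/-- The adjunction between functors on the codomain of a monotone map and sheaves on the
Alexandrov space of its domain. -/
noncomputable def alexandrovAdjunction (f : P ⟶ Q) :
    (Functor.whiskeringLeft P Q (Type u)).obj f.hom.monotone.functor ⋙
      (alexandrovEquivalence P).inverse ⊣ alexandrovPushforward f :=
  Adjunction.mkOfHomEquiv
    { homEquiv := fun E F => ((alexandrovEquivalence P).symm.toAdjunction.homEquiv _ F).trans
        (Equiv.ofBijective _ (alexandrovRestriction_bijective f E F)).symm
      homEquiv_naturality_left_symm := fun {E E' F} g ψ => by
        change ((alexandrovEquivalence P).symm.toAdjunction.homEquiv _ F).symm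
          (((Functor.whiskeringLeft P Q (Type u)).obj f.hom.monotone.functor).map g ≫
            Functor.whiskerLeft f.hom.monotone.functor ψ ≫ (alexandrovRestriction f).app F) = _
        rw [Adjunction.homEquiv_naturality_left_symm]
        rfl
      homEquiv_naturality_right := fun {E F F'} g k => by
        apply (Equiv.ofBijective _ (alexandrovRestriction_bijective f E F')).injective
        refine (Equiv.apply_symm_apply _ _).trans ?_
        rw [Adjunction.homEquiv_naturality_right]
        have h := (alexandrovRestriction f).naturality k
        have h' := Equiv.apply_symm_apply (Equiv.ofBijective _
          (alexandrovRestriction_bijective f E F))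
            ((alexandrovEquivalence P).symm.toAdjunction.homEquiv _ F g)
        refine (congrArg (· ≫ (alexandrovEquivalence P).functor.map k) h'.symm).trans ?_
        exact (Category.assoc _ _ _).trans ((congrArg (_ ≫ ·) h.symm).trans
          (Category.assoc _ _ _).symm) }

/-- The equivalence of toposes between sheaves on the Alexandrov space of a preorder and functors
on the preorder. -/
noncomputable def alexandrovGeom (P : Preord.{u}) :
    GeomMorph (Sheaf (Opens.grothendieckTopology (alexandrov.obj P)) (Type u)) (P ⥤ Type u) :=
  GeomMorph.ofEquivalence (alexandrovEquivalence P)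

/-! ### Points of Alexandrov spaces -/

/-- The values of a skyscraper sheaf on an Alexandrov space. -/
noncomputable def skyscraperAlexandrovIsoApp (p q : P) (S : Type u) :
    (∏ᶜ fun _ : ULift.{u} (PLift (Topology.WithUpperSet.toUpperSet p ∈ upperOpen P q)) => S) ≅
      ∏ᶜ fun _ : q ⟶ p => S :=
  Pi.whiskerEquiv
    { toFun := fun x => homOfLE x.down.down
      invFun := fun g => ⟨⟨g.le⟩⟩
      left_inv := fun _ => rfl
      right_inv := fun _ => rfl } (fun _ => Iso.refl S)

lemma skyscraperAlexandrovIsoApp_hom_π {p q : P} (S : Type u) (g : q ⟶ p) :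
    (skyscraperAlexandrovIsoApp p q S).hom ≫ Pi.π (fun _ : q ⟶ p => S) g =
      Pi.π (fun _ : ULift.{u} (PLift (Topology.WithUpperSet.toUpperSet p ∈ upperOpen P q)) => S)
        ⟨⟨g.le⟩⟩ :=
  (Pi.map'_comp_π _ _ _).trans (Category.comp_id _)

/-- Skyscraper sheaves on an Alexandrov space correspond to the right adjoint of evaluation. -/
noncomputable def skyscraperAlexandrovIso (P : Preord.{u}) (p : P) :
    (Opens.pointGrothendieckTopology (X := alexandrov.obj P)
        (Topology.WithUpperSet.toUpperSet p)).skyscraperSheafFunctor ⋙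
      (alexandrovEquivalence P).functor ≅ evaluationRightAdjoint (Type u) p :=
  -- Both sides at `q` are powers of `S`, indexed by proofs that `q ≤ p` and by arrows `q ⟶ p`;
  -- naturality is checked on projections.
  NatIso.ofComponents
    (fun S => NatIso.ofComponents (fun q => skyscraperAlexandrovIsoApp p q S) (fun {q q'} g => by
      apply Pi.hom_ext
      intro k
      have h : ((evaluationRightAdjoint (Type u) p).obj S).map g ≫
          Pi.π (fun _ : q' ⟶ p => S) k = Pi.π (fun _ : q ⟶ p => S) (g ≫ k) := Pi.lift_π _ _
      refine (Category.assoc _ _ _).trans ((whisker_eq _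
        (skyscraperAlexandrovIsoApp_hom_π S k)).trans (Eq.trans ?_ (Category.assoc _ _ _).symm))
      refine Eq.trans ?_ (whisker_eq _ h).symm
      refine Eq.trans ?_ (skyscraperAlexandrovIsoApp_hom_π S (g ≫ k)).symm
      exact (Pi.map'_comp_π _ _ _).trans (Category.comp_id _)))
    (fun {S T} k => by
      ext q : 2
      apply Pi.hom_ext
      intro l
      have h : ((evaluationRightAdjoint (Type u) p).map k).app q ≫
          Pi.π (fun _ : q ⟶ p => T) l = Pi.π (fun _ : q ⟶ p => S) l ≫ k := Pi.lift_π _ _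
      have h' : Limits.Pi.map (fun _ => k) ≫ Pi.π (fun _ : ULift.{u} (PLift
          (Topology.WithUpperSet.toUpperSet p ∈ upperOpen P q)) => T) ⟨⟨l.le⟩⟩ =
            Pi.π (fun _ => S) ⟨⟨l.le⟩⟩ ≫ k := Pi.map_π _ _
      refine (Category.assoc _ _ _).trans ((whisker_eq _
        (skyscraperAlexandrovIsoApp_hom_π T l)).trans (Eq.trans ?_ (Category.assoc _ _ _).symm))
      refine Eq.trans ?_ (whisker_eq _ h).symm
      refine Eq.trans ?_ (Category.assoc _ _ _)
      exact h'.trans (eq_whisker (skyscraperAlexandrovIsoApp_hom_π S l) k).symm)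

/-- The isomorphism of toposes paired with points from the Alexandrov space of a preorder to the
preorder. -/
noncomputable def alexandrovHom (P : Preord.{u}) :
    spaceFunctor.obj (alexandrov.obj P) ⟶ preordFunctor.obj P :=
  PointedTopos.Hom.mk (Q := preordFunctor.obj P) (GeomClass.mk (alexandrovGeom P))
    (fun x => Topology.WithUpperSet.ofUpperSet (α := P) x)
    (fun p => GeomClass.mk_eq_of_dir
      (f := (GeomMorph.ofPoint (Opens.pointGrothendieckTopology
        (X := alexandrov.obj P) (Topology.WithUpperSet.toUpperSet p))).comp (alexandrovGeom P))
      (skyscraperAlexandrovIso P p))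

instance (P : Preord.{u}) : IsIso (alexandrovHom P) :=
  PointedTopos.isIso_of_isEquivalence (alexandrovHom P) (alexandrovGeom P) rfl
    (inferInstanceAs (alexandrovEquivalence P).functor.IsEquivalence) Function.bijective_id

/-- The sheaf side has an explicit direct image, the preorder side an explicit inverse image. By
`alexandrovAdjunction` the latter, transported along the equivalence, is left adjoint to the former,
and left adjoints are unique. -/
lemma alexandrovHom_naturality (f : P ⟶ Q) :
    spaceFunctor.map (alexandrov.map f) ≫ alexandrovHom Q =
      alexandrovHom P ≫ preordFunctor.map f := by
  refine PointedTopos.Hom.ext ?_ rfl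
  exact GeomClass.mk_eq_of_inv
    (f := (GeomMorph.ofSite (Opens.map (alexandrov.map f)) _ _).comp (alexandrovGeom Q))
    (((GeomMorph.ofSite (Opens.map (alexandrov.map f)) _ _).comp
      (alexandrovGeom Q)).adj.leftAdjointUniq (alexandrovAdjunction f))

/-! ### The Alexandrov coreflection -/

/-- The topos paired with points of a preorder is that of its Alexandrov space. -/
noncomputable def alexandrovIso : alexandrov.{u} ⋙ spaceFunctor ≅ preordFunctor :=
  NatIso.ofComponents (F := alexandrov ⋙ spaceFunctor) (fun P => asIso (alexandrovHom P))
    alexandrovHom_naturality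

lemma alexandrovIso_inv_index (P : Preord.{u}) (p : P) :
    (alexandrovIso.inv.app P).index p = Topology.WithUpperSet.toUpperSet p :=
  congrFun (congrArg PointedTopos.Hom.index (alexandrovIso.inv_hom_id_app P)) p

/-- The adjunction between the Alexandrov and the specialization functors. -/
def alexandrovSpecializationAdjunction : alexandrov.{u} ⊣ specialization :=
  Adjunction.mkOfUnitCounit
    { unit :=
        { app := fun P => Preord.ofHom (Y := Specialization (Topology.WithUpperSet P))
            (orderIsoSpecializationWithUpperSetTopology P).toOrderEmbedding.toOrderHom
          naturality := fun _ _ _ => rfl }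
      counit :=
        { app := fun X => TopCat.ofHom
            { toFun := fun x => Specialization.ofEquiv (Topology.WithUpperSet.ofUpperSet x)
              -- Open sets of `X` are upper sets for the specialization preorder.
              continuous_toFun := continuous_def.2 fun _ hU _ _ hab ha =>
                (hab : _ ⤳ _).mem_open hU ha } } }

instance : IsIso alexandrovSpecializationAdjunction.{u}.unit := by
  have (P : Preord.{u}) : IsIso (alexandrovSpecializationAdjunction.unit.app P) :=
    inferInstanceAs (IsIso (Preord.Iso.mk (α := P)
      (β := Preord.of (Specialization (Topology.WithUpperSet P)))
      (orderIsoSpecializationWithUpperSetTopology P)).hom)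
  exact NatIso.isIso_of_isIso_app _

lemma exists_alexandrov_data :
    ∃ (Ψ : CofunctionalData preordFunctor.{u} spaceFunctor.{u} alexandrov.obj
          specialization.obj)
        (a : alexandrov.{u} ⊣ specialization.{u}),
      (∀ (P : Preord.{u}) (p : P), (Ψ.α P).index (Topology.WithUpperSet.toUpperSet p) = p) ∧
      (∀ (X : TopCat.{u}) (x : X), (Ψ.β X).index (Specialization.toEquiv x) = x) ∧
      (∀ (P : Preord.{u}) (X : TopCat.{u}) (h : alexandrov.obj P ⟶ X) (p : P),
        a.homEquiv P X h p = Specialization.toEquiv (h (Topology.WithUpperSet.toUpperSet p))) ∧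
      IsIso a.unit ∧
      Ψ.op.Yields (F := alexandrov.op) (G := specialization.op) a.op := by
  refine ⟨CofunctionalData.ofAdjunction alexandrovSpecializationAdjunction alexandrovIso,
    alexandrovSpecializationAdjunction, fun _ _ => rfl, fun X x => ?_, fun P X h p => ?_,
    inferInstance, CofunctionalData.yields_ofAdjunction _ _⟩
  · exact congrArg (alexandrovSpecializationAdjunction.counit.app X)
      (alexandrovIso_inv_index (specialization.obj X) (Specialization.toEquiv x))
  · rw [Adjunction.homEquiv_unit]
    rfl

end Alexandrov

end StoneAlexandrov

theorem mainTheorem5 :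
    (∃ (Φ : FunctionalData boolAlgFunctor.{u} spaceFunctor.{u} stoneSpectrum.obj
          clopenAlgebra.obj)
        (a : clopenAlgebra.{u} ⊣ stoneSpectrum.{u}),
      (∀ (B : BoolAlg.{u}ᵒᵖ) (p : (boolAlgFunctor.obj B).Index) (b : B.unop),
        StoneSpace.toHom (B := B.unop) ((Φ.ξ B).index p) b = true ↔
          PointClass.Holds ((boolAlgFunctor.obj B).pt p) b) ∧
      (∀ (X : TopCat.{u}) (x : X) (V : TopologicalSpace.Clopens X),
        PointClass.Holds ((boolAlgFunctor.obj (clopenAlgebra.obj X)).pt ((Φ.χ X).index x)) V ↔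
          x ∈ V) ∧
      (∀ (X : TopCat.{u}) (B : BoolAlg.{u}ᵒᵖ) (h : clopenAlgebra.obj X ⟶ B) (x : X)
          (b : B.unop),
        StoneSpace.toHom (B := B.unop) (a.homEquiv X B h x) b = true ↔
          x ∈ TopologicalSpace.Clopens.carrier (α := X) (h.unop b)) ∧
      IsIso a.counit ∧
      Φ.Yields a) ∧
    (∃ (Ψ : CofunctionalData preordFunctor.{u} spaceFunctor.{u} alexandrov.obj
          specialization.obj)
        (a : alexandrov.{u} ⊣ specialization.{u}),
      (∀ (P : Preord.{u}) (p : P), (Ψ.α P).index (Topology.WithUpperSet.toUpperSet p) = p) ∧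
      (∀ (X : TopCat.{u}) (x : X), (Ψ.β X).index (Specialization.toEquiv x) = x) ∧
      (∀ (P : Preord.{u}) (X : TopCat.{u}) (h : alexandrov.obj P ⟶ X) (p : P),
        a.homEquiv P X h p = Specialization.toEquiv (h (Topology.WithUpperSet.toUpperSet p))) ∧
      IsIso a.unit ∧
      Ψ.op.Yields (F := alexandrov.op) (G := specialization.op) a.op) :=
  ⟨exists_stone_data, exists_alexandrov_data⟩
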